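/- **Setting.** Let $\bar{\mathbb Q}$ be the algebraic closure of $\mathbb Q$ in $\mathbb C$ and $\mathfrak c$ complex conjugation. For a number field $K$ let $\Sigma_K=\mathrm{Hom}(K,\mathbb C)=\mathrm{Hom}(K,\bar{\mathbb Q})$ and $\bar\tau=\mathfrak c\circ\tau$. A Hecke character of $K$ is a continuous homomorphism $\chi:\mathbb I_K/K^\times\to\mathbb C^\times$ (not necessarily unitary), where $\mathbb I_K$ is the idèle group. It is algebraic of infinity type $(n_\tau)_{\tau\in\Sigma_K}$, $n_\tau\in\mathbb Z$, if for all $x\in K_\infty^\times=(K\otimes\mathbb R)^\times$ $$\chi(x)=\prod_{v\ \mathrm{real}}x_v^{n_{\tau_v}}\prod_{w\ \mathrm{complex}}z_w^{n_{\tau_w}}\,\bar z_w^{\,n_{\bar\tau_w}},$$ where $\tau_v$ is the embedding at a real place $v$, $\{\tau_w,\bar\tau_w\}$ is the pair of embeddings at a complex place $w$, and $z_w\in\mathbb C$ is the image of the component $x_w$ under $\tau_w$. For $K$ totally imaginary, $(n_\tau)$ is pure of weight $\mathsf w\in\mathbb Z$ if $n_{\gamma\circ\tau}+n_{\gamma\circ\bar\tau}=\mathsf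 w$ for all $\tau\in\Sigma_K$ and all $\gamma\in\mathrm{Gal}(\bar{\mathbb Q}/\mathbb Q)$. A Dirichlet character of $K$ is a (unitary) character of a narrow ray class group $\mathbb I_K/\mathbb U_K(\mathfrak m)K^\times$ for some nonzero integral ideal $\mathfrak m=\prod\mathfrak p^{m_{\mathfrak p}}$, viewed as a Hecke character (necessarily of finite order); here $\mathbb U_K(\mathfrak m)$ is the group of idèles that are units congruent to $1$ modulo $\mathfrak p^{m_{\mathfrak p}}$ at every finite prime $\mathfrak p$ and positive at every real place. Let $\|\ \|=\prod_{\mathfrak p}|\ |_{\mathfrak p}$ be the idèle norm (all places, normalized absolute values), and for an extension $L/K$ let $N_{L/K}:\mathbb I_L\to\mathbb I_K$ be the norm map of idèles. Let $F$ be a totally imaginary number field and $F_0$ its largest totally real subfield. Let $F_1$ be the totally imaginary quadratic extension of $F_0$ contained in $F$ if there is one, and $F_1=F_0$ otherwise. **Proposition.** Let $\mathbf n=(n_\tau)_{\tau\in\Sigma_F}$, $n_\tau\in\mathbb Z$, be pure of weight $\mathsf w$. Then there exists an algebraic Hecke character of $F$ of infinity type $\mathbf n$. Moreover $F_1=F_0$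 if and only if $F$ has no CM subfield, and $F_1$ is a CM field if and only if $F$ has a CM subfield, and: 1. If $F_1=F_0$, then there is $n\in\mathbb Z$ with $n_\tau=n$ for all $\tau\in\Sigma_F$, and every algebraic Hecke character $\chi$ of $F$ of infinity type $\mathbf n$ is of the form $\chi=\chi^\circ\,\|\ \|^{n}$ for a Dirichlet (hence finite-order) character $\chi^\circ$ of $F$. 2. If $F_1$ is a CM field, then there is an infinity type $\mathbf m=(m_{\tau_1})_{\tau_1\in\Sigma_{F_1}}$ of $F_1$, pure of weight $\mathsf w$, such that $n_\tau=m_{\tau|_{F_1}}$ for all $\tau\in\Sigma_F$, and every algebraic Hecke character $\chi$ of $F$ of infinity type $\mathbf n$ is of the form $\chi=(\chi_1\circ N_{F/F_1})\cdot\chi^\circ$ for some algebraic Hecke character $\chi_1$ of $F_1$ of infinity type $\mathbf m$ and some Dirichlet (hence finite-order) character $\chi^\circ$ of $F$. -/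

import Mathlib

open NumberField IsDedekindDomain
open scoped RestrictedProduct WithZero

noncomputable section
namespace HeckeChar

section Norm
variable (K L : Type*) [Field K] [NumberField K] [Field L] [NumberField L] [Algebra K L]

/-- The continuous extension `K_v → L_w` of the inclusion `K → L`, for finite places `w ∣ v`. -/
def finiteCompletionMap (v : HeightOneSpectrum (𝓞 K)) (w : HeightOneSpectrum (𝓞 L))
    [w.asIdeal.LiesOver v.asIdeal] : v.adicCompletion K →+* w.adicCompletion L :=
  ((HeightOneSpectrum.adicCompletion.equiv L w).symm.toRingHom.comp
    (UniformSpace.Completion.mapRingHom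
      (algebraMap (WithVal (v.valuation K)) (WithVal (w.valuation L)))
      (HeightOneSpectrum.uniformContinuous_algebraMap_liesOver K L v w).continuous)).comp
    (HeightOneSpectrum.adicCompletion.equiv K v).toRingHom

/-- The local norm `N_{L_w / K_v}` at finite places `w ∣ v`. -/
def finiteLocalNorm (v : HeightOneSpectrum (𝓞 K)) (w : HeightOneSpectrum (𝓞 L))
    [w.asIdeal.LiesOver v.asIdeal] : w.adicCompletion L →* v.adicCompletion K :=
  letI := (finiteCompletionMap K L v w).toAlgebra
  Algebra.norm (v.adicCompletion K)

/-- The local norm `N_{L_w / K_v}` at infinite places `w ∣ v`. -/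
def infiniteLocalNorm (v : InfinitePlace K) (w : InfinitePlace L) [w.LiesOver v] :
    w.Completion →* v.Completion :=
  letI := (NumberField.LiesOver.completionMap (v := v) (w := w)).toAlgebra
  Algebra.norm v.Completion

variable {K L}

theorem continuous_finiteCompletionMap (v : HeightOneSpectrum (𝓞 K)) (w : HeightOneSpectrum (𝓞 L))
    [w.asIdeal.LiesOver v.asIdeal] : Continuous (finiteCompletionMap K L v w) :=
  (HeightOneSpectrum.adicCompletion.continuous_ofCompletion L w).comp <|
    UniformSpace.Completion.continuous_map.comp
      (HeightOneSpectrum.adicCompletion.continuous_toCompletion K v)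

theorem finiteCompletionMap_algebraMap (v : HeightOneSpectrum (𝓞 K))
    (w : HeightOneSpectrum (𝓞 L)) [w.asIdeal.LiesOver v.asIdeal] (x : K) :
    finiteCompletionMap K L v w (algebraMap K _ x) = algebraMap L _ (algebraMap K L x) := by
  apply HeightOneSpectrum.adicCompletion.ext
  exact UniformSpace.Completion.mapRingHom_coe
    (HeightOneSpectrum.uniformContinuous_algebraMap_liesOver K L v w).continuous
    (algebraMap K (WithVal (v.valuation K)) x)

theorem adicCompletionIntegers_le_closure (w : HeightOneSpectrum (𝓞 L)) {x : w.adicCompletion L}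
    (hx : x ∈ w.adicCompletionIntegers L) :
    x ∈ closure (Set.range (algebraMap (𝓞 L) (w.adicCompletion L))) := by
  let _ : NontriviallyNormedField (w.adicCompletion L) := Valued.toNontriviallyNormedField _ ℤᵐ⁰
  rw [Metric.mem_closure_iff]
  intro ε hε
  obtain ⟨c, hc0, hc⟩ := NormedField.exists_norm_lt (w.adicCompletion L)
    (lt_min hε one_pos)
  obtain ⟨l, hl⟩ := (w.denseRange_algebraMap L).exists_dist_lt x hc0
  have hc1 : c ≠ 0 := norm_pos_iff.1 hc0
  have hlx : ‖x - algebraMap L _ l‖ < ‖c‖ := by simpa [dist_eq_norm] using hl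
  have hl1 : w.valuation L l ≤ 1 := by
    have h1 : ‖x‖ ≤ 1 := Valued.toNormedField.norm_le_one_iff.2 hx
    have h2 : ‖x - algebraMap L (w.adicCompletion L) l‖ ≤ 1 :=
      (hlx.trans (hc.trans_le (min_le_right _ _))).le
    have h3 : ‖algebraMap L (w.adicCompletion L) l‖ ≤ 1 := by
      have := IsUltrametricDist.norm_add_le_max x (-(x - algebraMap L (w.adicCompletion L) l))
      rw [norm_neg, ← sub_eq_add_neg, sub_sub_cancel] at this
      exact this.trans (max_le h1 h2)
    rw [← HeightOneSpectrum.adicCompletion.valued_coe]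
    exact Valued.toNormedField.norm_le_one_iff.1 h3
  obtain ⟨a, ha⟩ := w.exists_valuation_sub_lt_of_integer hl1
    (Units.mk0 (Valued.v c) ((Valuation.ne_zero_iff _).2 hc1))
  refine ⟨_, ⟨a, rfl⟩, ?_⟩
  have h4 : ‖algebraMap L (w.adicCompletion L) (algebraMap (𝓞 L) L a - l)‖ < ‖c‖ := by
    rw [Valued.toNormedField.norm_lt_iff]
    erw [HeightOneSpectrum.adicCompletion.valued_coe]
    exact ha
  rw [map_sub, ← IsScalarTower.algebraMap_apply] at h4
  have := IsUltrametricDist.norm_add_le_max (x - algebraMap L (w.adicCompletion L) l)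
    (-(algebraMap (𝓞 L) (w.adicCompletion L) a - algebraMap L (w.adicCompletion L) l))
  rw [norm_neg, ← sub_eq_add_neg, sub_sub_sub_cancel_right] at this
  rw [dist_eq_norm]
  exact this.trans_lt ((max_lt hlx h4).trans (hc.trans_le (min_le_left _ _)))

theorem finiteLocalNorm_mem (v : HeightOneSpectrum (𝓞 K)) (w : HeightOneSpectrum (𝓞 L))
    [w.asIdeal.LiesOver v.asIdeal] {x : w.adicCompletion L}
    (hx : x ∈ w.adicCompletionIntegers L) :
    finiteLocalNorm K L v w x ∈ v.adicCompletionIntegers K := by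
  let _ := (finiteCompletionMap K L v w).toAlgebra
  let _ : NontriviallyNormedField (v.adicCompletion K) := Valued.toNontriviallyNormedField _ ℤᵐ⁰
  have : ContinuousSMul (v.adicCompletion K) (w.adicCompletion L) :=
    ⟨((continuous_finiteCompletionMap v w).comp continuous_fst).mul continuous_snd⟩
  have : IsScalarTower K (v.adicCompletion K) (w.adicCompletion L) := .of_algebraMap_eq fun x ↦ by
    rw [RingHom.algebraMap_toAlgebra, finiteCompletionMap_algebraMap,
      ← IsScalarTower.algebraMap_apply]
  have hcont : Continuous (finiteLocalNorm K L v w) := by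
    let b := Module.finBasis (v.adicCompletion K) (w.adicCompletion L)
    have : ∀ y, finiteLocalNorm K L v w y = (Algebra.leftMulMatrix b y).det :=
      fun y ↦ Algebra.norm_eq_matrix_det b y
    simp_rw [funext this]
    exact Continuous.matrix_det
      (LinearMap.continuous_of_finiteDimensional (Algebra.leftMulMatrix b).toLinearMap)
  have hcl : IsClosed {y | finiteLocalNorm K L v w y ∈ v.adicCompletionIntegers K} :=
    (Valued.isClosed_integer (v.adicCompletion K)).preimage hcont
  refine hcl.closure_subset_iff.2 ?_ (adicCompletionIntegers_le_closure w hx)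
  rintro _ ⟨a, rfl⟩
  have h : IsIntegral (v.adicCompletionIntegers K) (algebraMap (𝓞 L) (w.adicCompletion L) a) :=
    (RingOfIntegers.isIntegral a).map_of_comp_eq (Int.castRingHom _) (algebraMap (𝓞 L) _)
      (RingHom.ext_int _ _)
  exact Valuation.Integers.mem_of_integral (HeightOneSpectrum.adicCompletionIntegers.integers K v)
    (Algebra.isIntegral_norm (v.adicCompletion K) h)

instance (v : HeightOneSpectrum (𝓞 K)) :
    Finite {w : HeightOneSpectrum (𝓞 L) // w.asIdeal.LiesOver v.asIdeal} := by
  have := Algebra.QuasiFinite.finite_primesOver (S := 𝓞 L) v.asIdeal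
  exact Finite.of_injective (β := v.asIdeal.primesOver (𝓞 L)) (fun w ↦ ⟨w.1.asIdeal, w.1.isPrime, w.2⟩)
    fun w w' h ↦ Subtype.ext (HeightOneSpectrum.ext (congrArg Subtype.val h))

variable (K L)

/-- The norm of a finite adele of `L`: its component at a finite place `v` of `K` is
the product over the places `w` above `v` of the local norms. -/
def finiteAdeleNorm : FiniteAdeleRing (𝓞 L) L →* FiniteAdeleRing (𝓞 K) K where
  toFun a := ⟨fun v ↦ ∏ᶠ w : {w : HeightOneSpectrum (𝓞 L) // w.asIdeal.LiesOver v.asIdeal},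
    haveI := w.2
    finiteLocalNorm K L v w.1 (a w.1), by
      have ha : {w : HeightOneSpectrum (𝓞 L) | a w ∉ w.adicCompletionIntegers L}.Finite := a.2
      refine (ha.biUnion (t := fun w ↦ {v | w.asIdeal.LiesOver v.asIdeal}) fun w _ ↦
        Set.Subsingleton.finite fun _ hv _ hv' ↦ HeightOneSpectrum.ext
          (hv.over.trans hv'.over.symm)).subset fun v hv ↦ ?_
      by_contra hcon
      refine hv (finprod_induction (· ∈ v.adicCompletionIntegers K) (one_mem _)
        (fun _ _ ↦ mul_mem) fun w ↦ ?_)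
      have := w.2
      refine finiteLocalNorm_mem v w.1 (by_contra fun h ↦ hcon ?_)
      exact Set.mem_biUnion (x := w.1) h w.2⟩
  map_one' := by
    refine FiniteAdeleRing.ext _ fun _ ↦ ?_
    exact finprod_eq_one_of_forall_eq_one fun _ ↦ map_one _
  map_mul' _ _ := by
    refine FiniteAdeleRing.ext _ fun _ ↦ ?_
    refine (finprod_congr fun _ ↦ ?_).trans
      (finprod_mul_distrib (Set.toFinite _) (Set.toFinite _))
    exact map_mul _ _ _

/-- The norm of an infinite adele of `L`: the product over `w ∣ v` of the local norms. -/
def infiniteAdeleNorm : InfiniteAdeleRing L →* InfiniteAdeleRing K where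
  toFun a v := ∏ᶠ w : {w : InfinitePlace L // w.LiesOver v},
    haveI := w.2
    infiniteLocalNorm K L v w.1 (a w.1)
  map_one' := funext fun _ ↦ finprod_eq_one_of_forall_eq_one fun _ ↦ map_one _
  map_mul' _ _ := funext fun _ ↦ (finprod_congr fun _ ↦ map_mul _ _ _).trans
      (finprod_mul_distrib (Set.toFinite _) (Set.toFinite _))

/-- The adelic norm `N_{L/K}`, place by place. -/
def adeleNorm : AdeleRing (𝓞 L) L →* AdeleRing (𝓞 K) K :=
  (infiniteAdeleNorm K L).prodMap (finiteAdeleNorm K L)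

/-- The idele norm `N_{L/K} : 𝕀_L → 𝕀_K`. -/
def ideleNorm : (AdeleRing (𝓞 L) L)ˣ →* (AdeleRing (𝓞 K) K)ˣ := Units.map (adeleNorm K L)

end Norm

section Ideles
variable (F : Type*) [Field F] [NumberField F]

/-- The idele group `𝕀_F`, with its usual topology (that of the units of the adele ring). -/
abbrev Ideles := (AdeleRing (𝓞 F) F)ˣ

/-- The image of `Fˣ` in the ideles. -/
def principalIdeles : Subgroup (Ideles F) :=
  (Units.map (algebraMap F (AdeleRing (𝓞 F) F) : F →* AdeleRing (𝓞 F) F)).range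

/-- The idele class group `𝕀_F / Fˣ`, with the quotient topology. -/
abbrev IdeleClassGroup := Ideles F ⧸ principalIdeles F

/-- A Hecke character: a continuous homomorphism `𝕀_F / Fˣ → ℂˣ`, not necessarily unitary. -/
abbrev HeckeCharacter := IdeleClassGroup F →ₜ* ℂˣ

/-- The inclusion `F_∞ˣ → 𝕀_F`, with component `1` at every finite place. -/
def infiniteIdele : (InfiniteAdeleRing F)ˣ →* Ideles F :=
  (MulEquiv.prodUnits (M := InfiniteAdeleRing F)
    (N := FiniteAdeleRing (𝓞 F) F)).symm.toMonoidHom.comp (MonoidHom.inl _ _)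

variable {F}

/-- The value of the Hecke character `χ` at an idele, as a complex number. -/
def HeckeCharacter.eval (χ : HeckeCharacter F) (α : Ideles F) : ℂ :=
  (χ (QuotientGroup.mk α) : ℂˣ)

/-- The absolute norm `‖α‖ = ∏_𝔭 |α_𝔭|_𝔭` of an idele, over all places, with the
normalized absolute values. -/
def ideleAbs (α : Ideles F) : ℝ :=
  (∏ v : InfinitePlace F, ‖α.1.1 v‖ ^ v.mult) * ∏ᶠ v : HeightOneSpectrum (𝓞 F), ‖α.1.2 v‖

open scoped Classical in
/-- `χ` is an algebraic Hecke character of infinity type `n = (n_τ)`, i.e. on `F_∞ˣ`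
`χ(x) = ∏_{v real} x_v ^ n_{τ_v} * ∏_{w complex} z_w ^ n_{τ_w} * conj(z_w) ^ n_{conj τ_w}`. -/
def HasInfinityType (χ : HeckeCharacter F) (n : (F →+* ℂ) → ℤ) : Prop :=
  ∀ x : (InfiniteAdeleRing F)ˣ, χ.eval (infiniteIdele F x) =
    ∏ v : InfinitePlace F,
      if v.IsReal then
        InfinitePlace.Completion.extensionEmbedding v (x.1 v) ^ n v.embedding
      else
        InfinitePlace.Completion.extensionEmbedding v (x.1 v) ^ n v.embedding *
          (starRingEnd ℂ) (InfinitePlace.Completion.extensionEmbedding v (x.1 v)) ^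
            n (ComplexEmbedding.conjugate v.embedding)

/-- The congruence group `𝕌_F(𝔪) = ∏_𝔭 U_𝔭(m_𝔭)`: units congruent to `1` modulo `𝔭 ^ m_𝔭` at the
finite primes, positive at the real places, arbitrary at the complex places. -/
def congruenceIdeles (m : Ideal (𝓞 F)) : Subgroup (Ideles F) where
  carrier := {α | (∀ p : HeightOneSpectrum (𝓞 F), Valued.v (α.1.2 p) = 1 ∧
      Valued.v (α.1.2 p - 1) ≤ WithZero.exp (-(multiplicity p.asIdeal m : ℤ))) ∧
    ∀ (v : InfinitePlace F) (hv : v.IsReal),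
      0 < InfinitePlace.Completion.extensionEmbeddingOfIsReal hv (α.1.1 v)}
  one_mem' := by
    refine ⟨fun p ↦ ?_, fun v hv ↦ ?_⟩
    · have h : (1 : Ideles F).1.2 p = 1 := rfl
      rw [h, sub_self, map_one, map_zero]
      exact ⟨rfl, zero_le⟩
    · have h : (1 : Ideles F).1.1 v = 1 := rfl
      rw [h, map_one]
      exact one_pos
  mul_mem' {α β} hα hβ := by
    refine ⟨fun p ↦ ?_, fun v hv ↦ ?_⟩
    · have h : (α * β).1.2 p = α.1.2 p * β.1.2 p := rfl
      obtain ⟨h1, h2⟩ := hα.1 p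
      obtain ⟨h3, h4⟩ := hβ.1 p
      refine ⟨by rw [h, map_mul, h1, h3, one_mul], ?_⟩
      have h5 : α.1.2 p * β.1.2 p - 1 = α.1.2 p * (β.1.2 p - 1) + (α.1.2 p - 1) := by ring
      rw [h, h5]
      exact Valuation.map_add_le _ (by rwa [map_mul, h1, one_mul]) h2
    · have h : (α * β).1.1 v = α.1.1 v * β.1.1 v := rfl
      rw [h, map_mul]
      exact mul_pos (hα.2 v hv) (hβ.2 v hv)
  inv_mem' {α} hα := by
    refine ⟨fun p ↦ ?_, fun v hv ↦ ?_⟩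
    · have h : α.1.2 p * (α⁻¹).1.2 p = 1 :=
        congrArg (fun a : AdeleRing (𝓞 F) F ↦ a.2 p) α.mul_inv
      obtain ⟨h1, h2⟩ := hα.1 p
      have h3 : Valued.v ((α⁻¹).1.2 p) = 1 := by
        simpa [h1] using congrArg Valued.v h
      refine ⟨h3, ?_⟩
      have h5 : (α⁻¹).1.2 p - 1 = -((α⁻¹).1.2 p * (α.1.2 p - 1)) := by
        linear_combination h
      rw [h5, Valuation.map_neg, map_mul, h3, one_mul]
      exact h2
    · have h : α.1.1 v * (α⁻¹).1.1 v = 1 :=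
        congrArg (fun a : AdeleRing (𝓞 F) F ↦ a.1 v) α.mul_inv
      have h6 := congrArg (InfinitePlace.Completion.extensionEmbeddingOfIsReal hv) h
      rw [map_mul, map_one] at h6
      exact pos_of_mul_pos_right (h6 ▸ one_pos) (hα.2 v hv).le

/-- The idele-theoretic narrow ray class group `𝕀_F / 𝕌_F(𝔪) Fˣ`. -/
abbrev NarrowRayClassGroup (m : Ideal (𝓞 F)) :=
  Ideles F ⧸ (congruenceIdeles m ⊔ principalIdeles F)

/-- `χ` is a Dirichlet character: it is the inflation of a unitary character of a narrow ray class
group, for some nonzero integral ideal. -/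
def IsDirichletCharacter (χ : HeckeCharacter F) : Prop :=
  ∃ m : Ideal (𝓞 F), m ≠ ⊥ ∧ ∃ ψ : NarrowRayClassGroup m →* Circle,
    ∀ α : Ideles F, χ.eval α = (ψ (QuotientGroup.mk α) : ℂ)

end Ideles

section Purity
variable {F : Type*} [Field F]

/-- The algebraic closure of `ℚ` inside `ℂ`. -/
abbrev QBar : IntermediateField ℚ ℂ := algebraicClosure ℚ ℂ

/-- Complex conjugation on `QBar`. -/
def conjQBar : QBar ≃ₐ[ℚ] QBar :=
  algebraicClosure.algEquivOfAlgEquiv (Complex.conjAe.restrictScalars ℚ)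

/-- An embedding into `QBar`, seen as an embedding into `ℂ`. -/
def toComplex (τ : F →+* QBar) : F →+* ℂ := (algebraMap QBar ℂ).comp τ

theorem toComplex_conjQBar_comp (τ : F →+* QBar) :
    toComplex ((conjQBar : QBar →+* QBar).comp τ) = ComplexEmbedding.conjugate (toComplex τ) := rfl

/-- The purity condition (for a totally imaginary field) `n_{γ∘τ} + n_{γ∘conj∘τ} = w` for all `τ : F → QBar` and
`γ ∈ Gal(QBar/ℚ)`. -/
def IsPure (n : (F →+* ℂ) → ℤ) (w : ℤ) : Prop :=
  ∀ (γ : QBar ≃ₐ[ℚ] QBar) (τ : F →+* QBar),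
    n (toComplex ((γ : QBar →+* QBar).comp τ)) +
      n (toComplex ((γ : QBar →+* QBar).comp ((conjQBar : QBar →+* QBar).comp τ))) = w

end Purity

section Subfields
variable {F : Type*} [Field F]

/-- `K` is a totally imaginary quadratic extension of `E`. -/
def IsTotImagQuadratic (E K : Subfield F) : Prop :=
  E ≤ K ∧ E.relfinrank K = 2 ∧ IsTotallyComplex K

/-- `K` is the subfield `F₁` of `F`: with `F₀` the largest totally real subfield of `F`, it is the
totally imaginary quadratic extension of `F₀` inside `F` if there is one, and `F₀` otherwise. -/
def IsMaximalCMOrReal (K : Subfield F) : Prop :=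
  IsTotImagQuadratic (maximalRealSubfield F) K ∨
    (K = maximalRealSubfield F ∧ ¬ ∃ K', IsTotImagQuadratic (maximalRealSubfield F) K')

variable (F) in
theorem exists_isMaximalCMOrReal : ∃ K : Subfield F, IsMaximalCMOrReal K := by
  by_cases h : ∃ K, IsTotImagQuadratic (maximalRealSubfield F) K
  · exact h.imp fun _ hK ↦ .inl hK
  · exact ⟨_, .inr ⟨rfl, h⟩⟩

end Subfields

end HeckeChar
end
open HeckeChar

/-! Existence. On the congruence group modulo 3, take the character `∏ τ(x) ^ n_τ` of the infinite
component. A principal idele in this group comes from a unit `u ≡ 1` mod 3; put `ε = ∏ τ(u) ^ n_τ`.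
By purity, each conjugate of `ε` times its complex conjugate is `N(u) ^ w = ±1`, so all conjugates
of `ε` lie on the unit circle. Since `ε - 1 = 3β` with `β` an algebraic integer, all conjugates of
`β` have absolute value at most 2/3, hence `β = 0` and `ε = 1` (`prod_embeddings_unit_eq_one`). As
`ℂˣ` is divisible, the character extends to the ideles trivially on `Fˣ` (`exists_extension`), and
it is continuous because it is so on an open subgroup.

Shape of the weights. Purity says that every Galois conjugate of complex conjugation replaces a
weight by `w` minus it, so a product of two such conjugates changes nothing. By Galois theory `n_τ`
depends only on the restriction of `τ` to `conjSubfield F`, where complex conjugation comes from the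
field itself (`IsPure.eq_of_comp_eq`). This subfield is `F₁`: either `F₀`, or `F₀ + F₀ e` with `e`
purely imaginary in every embedding. In the first case `τ` and its conjugate have equal weights, so
`2 n_τ = w`; in the second the weights descend to `F₁`.

Structure of the characters. Two Hecke characters with the same infinity type differ by one that is
trivial at infinity. As `ℂˣ` has no small subgroups, the latter kills a congruence group; modulo
that group and `Fˣ` the ideles have finite exponent, so it is a Dirichlet character
(`isDirichletCharacter_of_trivial`). The comparison is made with a power of the idele norm, or with
`χ₁ ∘ N`. That `χ₁ ∘ N` is a Hecke character requires `N` to preserve principal ideles, which at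
finite places is the factorisation of the global norm into local norms
(`prod_finiteLocalNorm_algebraMap`). -/

namespace HeckeChar

/-! ### Complex embeddings of the infinite adeles, and infinity types -/

section InfiniteEmbeddings
variable {K : Type*} [Field K]

open InfinitePlace InfinitePlace.Completion

open scoped Classical in
/-- The continuous extension of a complex embedding to the completion at its place. -/
noncomputable def completionEmbedding (τ : K →+* ℂ) : (InfinitePlace.mk τ).Completion →+* ℂ :=
  if τ = (InfinitePlace.mk τ).embedding then extensionEmbedding _
  else (starRingEnd ℂ).comp (extensionEmbedding _)

theorem continuous_completionEmbedding (τ : K →+* ℂ) : Continuous (completionEmbedding τ) := by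
  have h := (isometry_extensionEmbedding (InfinitePlace.mk τ)).continuous
  unfold completionEmbedding
  split_ifs
  · exact h
  · exact Complex.continuous_conj.comp h

theorem completionEmbedding_coe (τ : K →+* ℂ) (x : WithAbs (InfinitePlace.mk τ).1) :
    completionEmbedding τ (x : (InfinitePlace.mk τ).Completion) = τ (WithAbs.equiv _ x) := by
  unfold completionEmbedding
  split_ifs with h
  · rw [extensionEmbedding_coe, ← h]
  · rw [RingHom.comp_apply, extensionEmbedding_coe]
    have h' := (embedding_mk_eq τ).resolve_left (fun h' ↦ h h'.symm)
    rw [h']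
    simp

theorem completionEmbedding_surjective (τ : K →+* ℂ) (h : (InfinitePlace.mk τ).IsComplex) :
    Function.Surjective (completionEmbedding τ) := by
  have h := surjective_extensionEmbedding_of_isComplex h
  unfold completionEmbedding
  split_ifs
  · exact h
  · exact (starRingAut (R := ℂ)).surjective.comp h

/-- The continuous extension of a complex embedding to the infinite adeles. -/
noncomputable def infiniteAdeleEmbedding (τ : K →+* ℂ) : InfiniteAdeleRing K →+* ℂ :=
  (completionEmbedding τ).comp
    (Pi.evalRingHom (fun v : InfinitePlace K ↦ v.Completion) (InfinitePlace.mk τ))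

theorem continuous_infiniteAdele_apply (v : InfinitePlace K) :
    Continuous fun x : InfiniteAdeleRing K ↦ x v :=
  continuous_apply (A := fun v : InfinitePlace K ↦ v.Completion) v

theorem continuous_infiniteAdeleEmbedding (τ : K →+* ℂ) :
    Continuous (infiniteAdeleEmbedding τ) :=
  (continuous_completionEmbedding τ).comp (continuous_infiniteAdele_apply _)

theorem infiniteAdeleEmbedding_algebraMap (τ : K →+* ℂ) (x : K) :
    infiniteAdeleEmbedding τ (algebraMap K _ x) = τ x :=
  completionEmbedding_coe τ ((WithAbs.equiv _).symm x)

variable [NumberField K]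

/-- `K` is dense in its infinite adeles, so identities between continuous functions can be checked
on `K`. -/
theorem infiniteAdele_funext {f g : InfiniteAdeleRing K → ℂ} (hf : Continuous f)
    (hg : Continuous g) (h : ∀ x : K, f (algebraMap K _ x) = g (algebraMap K _ x)) : f = g :=
  (InfiniteAdeleRing.denseRange_algebraMap K).equalizer hf hg (funext h)

theorem infiniteAdeleEmbedding_embedding (v : InfinitePlace K) (x : InfiniteAdeleRing K) :
    infiniteAdeleEmbedding v.embedding x = extensionEmbedding v (x v) := by
  refine congrFun (infiniteAdele_funext (continuous_infiniteAdeleEmbedding _)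
    ((isometry_extensionEmbedding v).continuous.comp (continuous_infiniteAdele_apply v))
    fun y ↦ ?_) x
  rw [infiniteAdeleEmbedding_algebraMap]
  exact (extensionEmbedding_coe v ((WithAbs.equiv _).symm y)).symm

theorem infiniteAdeleEmbedding_conjugate (τ : K →+* ℂ) (x : InfiniteAdeleRing K) :
    infiniteAdeleEmbedding (ComplexEmbedding.conjugate τ) x =
      starRingEnd ℂ (infiniteAdeleEmbedding τ x) := by
  refine congrFun (infiniteAdele_funext (continuous_infiniteAdeleEmbedding _)
    (Complex.continuous_conj.comp (continuous_infiniteAdeleEmbedding τ)) fun y ↦ ?_) x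
  simp [infiniteAdeleEmbedding_algebraMap]

/-- The character `x ↦ ∏ τ(x) ^ n_τ` of the infinite ideles. -/
noncomputable def infinityTypeHom (n : (K →+* ℂ) → ℤ) : (InfiniteAdeleRing K)ˣ →* ℂˣ :=
  ∏ τ, (zpowGroupHom (n τ)).comp (Units.map (infiniteAdeleEmbedding τ : _ →* ℂ))

theorem infinityTypeHom_apply (n : (K →+* ℂ) → ℤ) (x : (InfiniteAdeleRing K)ˣ) :
    (infinityTypeHom n x : ℂ) = ∏ τ, infiniteAdeleEmbedding τ x.1 ^ n τ := by
  simp [infinityTypeHom]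

theorem continuous_infinityTypeHom (n : (K →+* ℂ) → ℤ) : Continuous (infinityTypeHom n) := by
  have h : ⇑(infinityTypeHom n) = fun x ↦ ∏ τ : K →+* ℂ,
      (Units.map (infiniteAdeleEmbedding τ : _ →* ℂ) x) ^ n τ := by
    ext x; simp [infinityTypeHom]
  rw [h]
  exact continuous_finsetProd _ fun τ _ ↦
    (Continuous.units_map _ (continuous_infiniteAdeleEmbedding τ)).zpow _

open scoped Classical in
theorem prod_embeddings_eq_prod_places [IsTotallyComplex K] (f : (K →+* ℂ) → ℂ) :
    ∏ τ, f τ = ∏ v : InfinitePlace K,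
      f v.embedding * f (ComplexEmbedding.conjugate v.embedding) := by
  rw [← Finset.prod_fiberwise Finset.univ (fun τ : K →+* ℂ ↦ InfinitePlace.mk τ)]
  refine Finset.prod_congr rfl fun v _ ↦ ?_
  have h : (Finset.univ.filter fun τ : K →+* ℂ ↦ InfinitePlace.mk τ = v) =
      {v.embedding, ComplexEmbedding.conjugate v.embedding} := by
    ext τ
    simp only [Finset.mem_filter, Finset.mem_univ, true_and, Finset.mem_insert,
      Finset.mem_singleton]
    rw [← mk_embedding v, mk_eq_iff, mk_embedding, ← star_eq_iff_star_eq, eq_comm (a := star _)]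
  rw [h, Finset.prod_pair]
  intro h'
  exact (isComplex_iff.1 (IsTotallyComplex.isComplex v)) h'.symm

/-- Trades the product over places for one over embeddings, where the Galois action and restriction
to subfields are visible. Each complex place carries exactly two embeddings. -/
theorem hasInfinityType_iff [IsTotallyComplex K] (χ : HeckeCharacter K) (n : (K →+* ℂ) → ℤ) :
    HasInfinityType χ n ↔
      ∀ x, χ (QuotientGroup.mk (infiniteIdele K x)) = infinityTypeHom n x := by
  refine forall_congr' fun x ↦ ?_
  rw [HeckeCharacter.eval, Units.ext_iff, infinityTypeHom_apply, prod_embeddings_eq_prod_places]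
  refine Eq.congr_right (Finset.prod_congr rfl fun v _ ↦ ?_)
  rw [if_neg (not_isReal_iff_isComplex.2 (IsTotallyComplex.isComplex v)),
    infiniteAdeleEmbedding_conjugate, infiniteAdeleEmbedding_embedding]

end InfiniteEmbeddings

/-! ### The norm at the infinite places -/

section InfiniteNorm
variable {K L : Type*} [Field K] [Field L] [Algebra K L]

open InfinitePlace InfinitePlace.Completion

theorem mk_liesOver_mk {σ : K →+* ℂ} {τ : L →+* ℂ} (h : τ.comp (algebraMap K L) = σ) :
    (InfinitePlace.mk τ).LiesOver (InfinitePlace.mk σ) :=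
  haveI : ComplexEmbedding.LiesOver τ σ := ⟨h⟩
  inferInstance

theorem completionEmbedding_completionMap {σ : K →+* ℂ} {τ : L →+* ℂ}
    (h : τ.comp (algebraMap K L) = σ) (x : (InfinitePlace.mk σ).Completion) :
    haveI := mk_liesOver_mk h
    completionEmbedding τ (NumberField.LiesOver.completionMap (v := InfinitePlace.mk σ)
      (w := InfinitePlace.mk τ) x) = completionEmbedding σ x := by
  have := mk_liesOver_mk h
  induction x using Completion.induction_on with
  | hp =>
    exact isClosed_eq ((continuous_completionEmbedding τ).comp
      NumberField.LiesOver.continuous_completionMap) (continuous_completionEmbedding σ)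
  | ih a =>
    rw [NumberField.LiesOver.completionMap_coe, completionEmbedding_coe, completionEmbedding_coe]
    exact RingHom.congr_fun h (WithAbs.equiv _ a)

/-- The completion of `K` is already `ℂ`, so the local extension has degree 1 and its norm inverts
the inclusion. -/
theorem completionEmbedding_infiniteLocalNorm [IsTotallyComplex K] {σ : K →+* ℂ} {τ : L →+* ℂ}
    (h : τ.comp (algebraMap K L) = σ) (y : (InfinitePlace.mk τ).Completion) :
    haveI := mk_liesOver_mk h
    completionEmbedding σ (infiniteLocalNorm K L (InfinitePlace.mk σ) (InfinitePlace.mk τ) y) =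
      completionEmbedding τ y := by
  have := mk_liesOver_mk h
  let _ := (NumberField.LiesOver.completionMap (v := InfinitePlace.mk σ)
    (w := InfinitePlace.mk τ)).toAlgebra
  have hsurj : Function.Surjective (algebraMap (InfinitePlace.mk σ).Completion
      (InfinitePlace.mk τ).Completion) := fun y ↦ by
    obtain ⟨z, hz⟩ := completionEmbedding_surjective σ (IsTotallyComplex.isComplex _)
      (completionEmbedding τ y)
    exact ⟨z, (completionEmbedding τ).injective
      ((completionEmbedding_completionMap h z).trans hz)⟩
  obtain ⟨z, rfl⟩ := hsurj y
  have hrank : Module.finrank (InfinitePlace.mk σ).Completion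
      (InfinitePlace.mk τ).Completion = 1 := by
    rw [← Module.finrank_self (InfinitePlace.mk σ).Completion]
    exact (LinearEquiv.ofBijective (Algebra.linearMap (InfinitePlace.mk σ).Completion
      (InfinitePlace.mk τ).Completion)
      ⟨(algebraMap (InfinitePlace.mk σ).Completion
        (InfinitePlace.mk τ).Completion).injective, hsurj⟩).finrank_eq.symm
  have : infiniteLocalNorm K L (InfinitePlace.mk σ) (InfinitePlace.mk τ)
      (algebraMap (InfinitePlace.mk σ).Completion _ z) = z := by
    refine (Algebra.norm_algebraMap z).trans ?_
    rw [hrank, pow_one]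
  rw [this]
  exact (completionEmbedding_completionMap h z).symm

variable [NumberField L]

-- Since `σ` is not real, each place above that of `σ` carries exactly one embedding extending `σ`,
-- so the product over places becomes a product over embeddings.
open scoped Classical in
theorem infiniteAdeleEmbedding_infiniteAdeleNorm [IsTotallyComplex K] (σ : K →+* ℂ)
    (x : InfiniteAdeleRing L) :
    infiniteAdeleEmbedding σ (infiniteAdeleNorm K L x) =
      ∏ τ : L →+* ℂ with τ.comp (algebraMap K L) = σ, infiniteAdeleEmbedding τ x := by
  have h1 : infiniteAdeleEmbedding σ (infiniteAdeleNorm K L x) =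
      ∏ᶠ w : {w : InfinitePlace L // w.LiesOver (InfinitePlace.mk σ)},
        haveI := w.2
        completionEmbedding σ (infiniteLocalNorm K L (InfinitePlace.mk σ) w.1 (x w.1)) :=
    (completionEmbedding σ).toMonoidHom.map_finprod (Set.toFinite _)
  rw [h1, Finset.prod_filter, ← finprod_eq_prod_of_fintype]
  have h2 : ∏ᶠ τ : L →+* ℂ, (if τ.comp (algebraMap K L) = σ then infiniteAdeleEmbedding τ x else 1)
      = ∏ᶠ τ : {τ : L →+* ℂ // τ.comp (algebraMap K L) = σ}, infiniteAdeleEmbedding τ.1 x := by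
    rw [finprod_subtype_eq_finprod_cond (f := fun τ : L →+* ℂ ↦ infiniteAdeleEmbedding τ x)]
    refine finprod_congr fun τ ↦ ?_
    split_ifs with h <;> simp [h]
  rw [h2]
  symm
  refine finprod_eq_of_bijective (fun τ ↦ ⟨InfinitePlace.mk τ.1, mk_liesOver_mk τ.2⟩) ⟨?_, ?_⟩
    fun τ ↦ (completionEmbedding_infiniteLocalNorm τ.2 _).symm
  · rintro ⟨τ, hτ⟩ ⟨τ', hτ'⟩ h
    rcases mk_eq_iff.1 (congrArg Subtype.val h) with h | h
    · exact Subtype.ext h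
    -- If both `τ` and its conjugate restricted to `σ`, then `σ` would be real.
    · exfalso
      have h3 : ComplexEmbedding.IsReal σ := by
        refine (?_ : ComplexEmbedding.conjugate σ = σ)
        calc ComplexEmbedding.conjugate σ
            = (ComplexEmbedding.conjugate τ).comp (algebraMap K L) := by rw [← hτ]; rfl
          _ = σ := (congrArg (RingHom.comp · (algebraMap K L)) h).trans hτ'
      exact (IsTotallyComplex.complexEmbedding_not_isReal σ) h3
  · rintro ⟨w, hw⟩
    have h4 : InfinitePlace.mk (w.embedding.comp (algebraMap K L)) = InfinitePlace.mk σ := by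
      rw [← comap_mk, mk_embedding, LiesOver.comap_eq w (InfinitePlace.mk σ)]
    rcases mk_eq_iff.1 h4 with h | h
    · exact ⟨⟨w.embedding, h⟩, Subtype.ext (mk_embedding w)⟩
    · refine ⟨⟨ComplexEmbedding.conjugate w.embedding, h⟩, Subtype.ext ?_⟩
      simp

variable [NumberField K]

open scoped Classical in
theorem infinityTypeHom_infiniteAdeleNorm [IsTotallyComplex K] (m : (K →+* ℂ) → ℤ)
    (x : (InfiniteAdeleRing L)ˣ) :
    infinityTypeHom m (Units.map (infiniteAdeleNorm K L) x) =
      infinityTypeHom (fun τ : L →+* ℂ ↦ m (τ.comp (algebraMap K L))) x := by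
  ext
  rw [infinityTypeHom_apply, infinityTypeHom_apply, ← Finset.prod_fiberwise Finset.univ
    (fun τ : L →+* ℂ ↦ τ.comp (algebraMap K L))]
  refine Finset.prod_congr rfl fun σ _ ↦ ?_
  rw [Units.coe_map, infiniteAdeleEmbedding_infiniteAdeleNorm, ← Finset.prod_zpow]
  refine Finset.prod_congr rfl fun τ hτ ↦ ?_
  rw [(Finset.mem_filter.1 hτ).2]

open scoped Classical in
theorem infiniteAdeleNorm_algebraMap [IsTotallyComplex K] (x : L) :
    infiniteAdeleNorm K L (algebraMap L _ x) = algebraMap K _ (Algebra.norm K x) := by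
  refine funext fun v ↦ ?_
  apply (extensionEmbedding v).injective
  rw [← infiniteAdeleEmbedding_embedding, ← infiniteAdeleEmbedding_embedding,
    infiniteAdeleEmbedding_algebraMap, infiniteAdeleEmbedding_infiniteAdeleNorm]
  let _ := v.embedding.toAlgebra
  have := Algebra.norm_eq_prod_embeddings K ℂ x
  rw [RingHom.algebraMap_toAlgebra] at this
  rw [this, Finset.prod_filter, ← finprod_eq_prod_of_fintype, ← finprod_eq_prod_of_fintype]
  have h2 : ∏ᶠ τ : L →+* ℂ, (if τ.comp (algebraMap K L) = v.embedding then
        infiniteAdeleEmbedding τ (algebraMap L _ x) else 1)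
      = ∏ᶠ τ : {τ : L →+* ℂ // τ.comp (algebraMap K L) = v.embedding}, τ.1 x := by
    rw [finprod_subtype_eq_finprod_cond (f := fun τ : L →+* ℂ ↦ τ x)]
    refine finprod_congr fun τ ↦ ?_
    split_ifs with h <;> simp [h, infiniteAdeleEmbedding_algebraMap]
  rw [h2]
  symm
  exact finprod_eq_of_bijective (fun φ : L →ₐ[K] ℂ ↦ ⟨φ.toRingHom, φ.comp_algebraMap⟩)
    ⟨fun φ ψ h ↦ AlgHom.coe_ringHom_injective (congrArg Subtype.val h), fun τ ↦
      ⟨⟨τ.1, fun y ↦ RingHom.congr_fun τ.2 y⟩, rfl⟩⟩ fun _ ↦ rfl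

end InfiniteNorm

/-! ### Congruences in the completions at finite places -/

section LocalFields
variable {F : Type*} [Field F] [NumberField F] (p : HeightOneSpectrum (𝓞 F))

theorem exists_valued_eq_exp (k : ℤ) :
    ∃ c : p.adicCompletion F, c ≠ 0 ∧ Valued.v c = WithZero.exp k := by
  obtain ⟨c, hc⟩ := HeightOneSpectrum.valuedAdicCompletion_surjective F p (WithZero.exp k)
  exact ⟨c, fun h ↦ WithZero.exp_ne_zero (hc.symm.trans (by rw [h, map_zero])), hc⟩

theorem isOpen_valued_sub_le (a : p.adicCompletion F) (k : ℤ) :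
    IsOpen {x : p.adicCompletion F | Valued.v (x - a) ≤ WithZero.exp (-k)} := by
  obtain ⟨c, hc, hck⟩ := exists_valued_eq_exp p k
  have h := (Valued.isOpen_valuationSubring (p.adicCompletion F)).preimage
    (f := fun x ↦ c * (x - a)) (by fun_prop)
  convert h using 1
  ext x
  change _ ↔ Valued.v (c * (x - a)) ≤ 1
  rw [map_mul, hck, ← le_inv_mul_iff₀ (by simp), mul_one, ← WithZero.exp_neg]
  rfl

theorem exists_valued_sub_le_subset {a : p.adicCompletion F} {U : Set (p.adicCompletion F)}
    (hU : U ∈ nhds a) : ∃ k : ℕ, {x | Valued.v (x - a) ≤ WithZero.exp (-(k : ℤ))} ⊆ U := by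
  let _ : NontriviallyNormedField (p.adicCompletion F) := Valued.toNontriviallyNormedField _ ℤᵐ⁰
  obtain ⟨ε, hε, hU⟩ := Metric.mem_nhds_iff.1 hU
  obtain ⟨c, hc0, hc⟩ := NormedField.exists_norm_lt (p.adicCompletion F) hε
  have hc1 : (Valued.v c : ℤᵐ⁰) ≠ 0 := (Valuation.ne_zero_iff _).2 (norm_pos_iff.1 hc0)
  refine ⟨(-WithZero.log (Valued.v c)).toNat, fun x hx ↦ hU ?_⟩
  rw [mem_ball_iff_norm]
  refine lt_of_le_of_lt ?_ hc
  rw [Valued.toNormedField.norm_le_iff]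
  refine hx.trans ?_
  rw [← WithZero.exp_log hc1, WithZero.exp_le_exp, WithZero.exp_log hc1]
  have := Int.self_le_toNat (-WithZero.log (Valued.v c))
  omega

theorem valued_pow_sub_pow_le {a b : p.adicCompletion F} (ha : Valued.v a ≤ 1)
    (hb : Valued.v b ≤ 1) (n : ℕ) : Valued.v (a ^ n - b ^ n) ≤ Valued.v (a - b) := by
  obtain ⟨c, hc⟩ := sub_dvd_pow_sub_pow (⟨a, ha⟩ : p.adicCompletionIntegers F) ⟨b, hb⟩ n
  have hc' : a ^ n - b ^ n = (a - b) * c := congrArg Subtype.val hc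
  rw [hc', map_mul]
  exact mul_le_of_le_one_right' c.2

theorem valued_algebraMap (x : F) :
    Valued.v (algebraMap F (p.adicCompletion F) x) = p.valuation F x :=
  HeightOneSpectrum.valuedAdicCompletion_eq_valuation' p x

theorem valued_algebraMap_integer (a : 𝓞 F) :
    Valued.v (algebraMap (𝓞 F) (p.adicCompletion F) a) = p.intValuation a := by
  rw [IsScalarTower.algebraMap_apply (𝓞 F) F, valued_algebraMap,
    HeightOneSpectrum.valuation_of_algebraMap]

/-- A power of every unit of the completion at `p` is congruent to `1` modulo `p ^ k`. -/
theorem exists_pow_valued_sub_one_le (k : ℕ) : ∃ N : ℕ, 0 < N ∧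
    ∀ u : p.adicCompletion F, Valued.v u = 1 → Valued.v (u ^ N - 1) ≤ WithZero.exp (-(k : ℤ)) := by
  have : Finite (𝓞 F ⧸ p.asIdeal ^ k) :=
    Ideal.finiteQuotientOfFreeOfNeBot _ (pow_ne_zero k p.ne_bot)
  refine ⟨Nat.card (𝓞 F ⧸ p.asIdeal ^ k)ˣ, Nat.card_pos, fun u hu ↦ ?_⟩
  -- For `k = 0` an approximation of `u` modulo `p ^ k` need not be a unit at `p`, so this case is
  -- separate.
  rcases k.eq_zero_or_pos with rfl | hk
  · simpa [hu] using Valuation.map_sub (Valued.v : Valuation (p.adicCompletion F) ℤᵐ⁰)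
      (u ^ Nat.card (𝓞 F ⧸ p.asIdeal ^ 0)ˣ) 1
  -- Replace `u` by a global integer `a` congruent to it modulo `p ^ k`; the exponent is the order
  -- of the unit group of `𝓞 F ⧸ p ^ k`.
  obtain ⟨_, hy, a, rfl⟩ := mem_closure_iff.1 (adicCompletionIntegers_le_closure p hu.le) _
    (isOpen_valued_sub_le p u k) (by simp)
  have hlt : (WithZero.exp (-(k : ℤ)) : ℤᵐ⁰) < 1 := by
    rw [← WithZero.exp_zero, WithZero.exp_lt_exp]; omega
  have ha1 : Valued.v (algebraMap (𝓞 F) (p.adicCompletion F) a) = 1 := by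
    rw [← hu]
    refine Valuation.map_eq_of_sub_lt _ (lt_of_le_of_lt ?_ (hlt.trans_eq hu.symm))
    exact hy
  have ha2 : a ∉ p.asIdeal := by
    rw [valued_algebraMap_integer] at ha1
    exact HeightOneSpectrum.intValuation_eq_one_iff.1 ha1
  have hunit : IsUnit (Ideal.Quotient.mk (p.asIdeal ^ k) a) := by
    obtain ⟨y, i, hi, h⟩ := p.isMaximal.exists_inv ha2
    have hnil : IsNilpotent (Ideal.Quotient.mk (p.asIdeal ^ k) i) :=
      ⟨k, by rw [← map_pow]; exact Ideal.Quotient.eq_zero_iff_mem.2 (Ideal.pow_mem_pow hi k)⟩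
    refine isUnit_of_mul_isUnit_right (x := Ideal.Quotient.mk (p.asIdeal ^ k) y) ?_
    rw [← map_mul, eq_sub_of_add_eq h, map_sub, map_one]
    exact hnil.isUnit_one_sub
  obtain ⟨b, hb⟩ := hunit
  have hpow : a ^ Nat.card (𝓞 F ⧸ p.asIdeal ^ k)ˣ - 1 ∈ p.asIdeal ^ k := by
    rw [← Ideal.Quotient.eq_zero_iff_mem, map_sub, map_pow, ← hb, ← Units.val_pow_eq_pow_val,
      pow_card_eq_one']
    simp
  have h1 := valued_pow_sub_pow_le p hu.le ha1.le (Nat.card (𝓞 F ⧸ p.asIdeal ^ k)ˣ)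
  have h2 : Valued.v (algebraMap (𝓞 F) (p.adicCompletion F) a ^ Nat.card (𝓞 F ⧸ p.asIdeal ^ k)ˣ - 1)
      ≤ WithZero.exp (-(k : ℤ)) := by
    rw [← map_pow, ← map_one (algebraMap (𝓞 F) (p.adicCompletion F)), ← map_sub]
    rw [valued_algebraMap_integer]
    exact (p.intValuation_le_pow_iff_mem _ _).2 hpow
  rw [← sub_add_sub_cancel _ (algebraMap (𝓞 F) (p.adicCompletion F) a ^ _)]
  refine Valuation.map_add_le _ (h1.trans ?_) h2
  rw [Valuation.map_sub_swap]
  exact hy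

end LocalFields

/-! ### Finiteness of the class group, on ideles -/

section ClassNumber
variable {F : Type*} [Field F] [NumberField F]

/-- A generator of the principal ideal `p ^ h`, with `h` the class number, works. -/
theorem exists_valuation_eq_exp_classNumber (p : HeightOneSpectrum (𝓞 F)) :
    ∃ x : Fˣ, p.valuation F (x : F) = WithZero.exp (-(Nat.card (ClassGroup (𝓞 F)) : ℤ)) ∧
      ∀ q : HeightOneSpectrum (𝓞 F), q ≠ p → q.valuation F (x : F) = 1 := by
  let I : nonZeroDivisors (Ideal (𝓞 F)) :=
    ⟨p.asIdeal, mem_nonZeroDivisors_of_ne_zero p.ne_bot⟩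
  have h1 : ClassGroup.mk0 (I ^ Nat.card (ClassGroup (𝓞 F))) = 1 := by
    rw [map_pow]
    exact pow_card_eq_one'
  obtain ⟨a, ha⟩ := ((ClassGroup.mk0_eq_one_iff (I ^ Nat.card (ClassGroup (𝓞 F))).2).1 h1).principal
  replace ha : p.asIdeal ^ Nat.card (ClassGroup (𝓞 F)) = Ideal.span {a} := ha
  have ha0 : a ≠ 0 := by
    rintro rfl
    exact pow_ne_zero _ p.ne_bot (ha.trans (by simp))
  refine ⟨Units.mk0 (a : F) (by simpa using ha0), ?_, fun q hq ↦ ?_⟩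
  · refine (HeightOneSpectrum.valuation_of_algebraMap p a).trans ?_
    rw [p.intValuation_eq_exp_neg_multiplicity ha0, ← ha,
      multiplicity_pow_self p.ne_bot (by simpa using p.isPrime.ne_top)]
  · refine (HeightOneSpectrum.valuation_eq_one_iff_notMem (K := F) q).2 fun haq ↦ hq ?_
    have : p.asIdeal ^ Nat.card (ClassGroup (𝓞 F)) ≤ q.asIdeal := by
      rw [ha]; simpa [Ideal.span_le] using haq
    exact HeightOneSpectrum.ext ((p.isMaximal.eq_of_le q.isPrime.ne_top
      (q.isPrime.le_of_pow_le this)).symm)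

/-- The class-number-th power of an idele is principal up to units at all finite places. -/
theorem exists_valuation_eq_pow_classNumber (α : Ideles F) :
    ∃ x : Fˣ, ∀ p : HeightOneSpectrum (𝓞 F),
      p.valuation F (x : F) = Valued.v (α.1.2 p) ^ Nat.card (ClassGroup (𝓞 F)) := by
  classical
  choose x hx hx' using exists_valuation_eq_exp_classNumber (F := F)
  have hα : IsUnit α.1.2 := ⟨Units.map (RingHom.snd (InfiniteAdeleRing F)
    (FiniteAdeleRing (𝓞 F) F)).toMonoidHom α, rfl⟩
  obtain ⟨h0, h1⟩ := FiniteAdeleRing.isUnit_iff.1 hα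
  have hfin : {p : HeightOneSpectrum (𝓞 F) | Valued.v (α.1.2 p) ≠ 1}.Finite := h1
  refine ⟨∏ p ∈ hfin.toFinset, x p ^ (-WithZero.log (Valued.v (α.1.2 p))), fun p ↦ ?_⟩
  have hp0 : (Valued.v (α.1.2 p) : ℤᵐ⁰) ≠ 0 := (Valuation.ne_zero_iff _).2 (h0 p)
  have hval : ∀ q, p.valuation F ((x q ^ (-WithZero.log (Valued.v (α.1.2 q))) : Fˣ) : F) =
      if q = p then Valued.v (α.1.2 p) ^ Nat.card (ClassGroup (𝓞 F)) else 1 := by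
    intro q
    rw [Units.val_zpow_eq_zpow_val, map_zpow₀]
    split_ifs with h
    · subst h
      rw [hx, ← WithZero.exp_zsmul, smul_neg, neg_smul, neg_neg, smul_eq_mul]
      conv_rhs => rw [← WithZero.exp_log hp0, ← WithZero.exp_nsmul, nsmul_eq_mul]
      rw [mul_comm]
    · rw [hx' q p (Ne.symm h), one_zpow]
  rw [Units.coe_prod, map_prod, Finset.prod_congr rfl fun q _ ↦ hval q, Finset.prod_ite_eq']
  split_ifs with h
  · rfl
  · have : Valued.v (α.1.2 p) = 1 := by simpa using h
    rw [this, one_pow]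

end ClassNumber

/-! ### Congruence groups and the topology of the ideles -/

section IdeleTopology
variable {F : Type*} [Field F] [NumberField F]

open Topology

theorem continuous_finiteAdele_apply (p : HeightOneSpectrum (𝓞 F)) :
    Continuous fun a : FiniteAdeleRing (𝓞 F) F ↦ a p :=
  RestrictedProduct.continuous_eval (R := fun v : HeightOneSpectrum (𝓞 F) ↦ v.adicCompletion F)
    (A := fun v ↦ (v.adicCompletionIntegers F : Set (v.adicCompletion F))) p

theorem isOpen_forall_mem_integers :
    IsOpen {a : FiniteAdeleRing (𝓞 F) F | ∀ p, a p ∈ p.adicCompletionIntegers F} :=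
  RestrictedProduct.isOpen_forall_mem
    (R := fun v : HeightOneSpectrum (𝓞 F) ↦ v.adicCompletion F)
    (A := fun v ↦ (v.adicCompletionIntegers F : Set (v.adicCompletion F)))
    fun _ ↦ Valued.isOpen_valuationSubring _

theorem valued_finite_mul_inv (α : Ideles F) (p : HeightOneSpectrum (𝓞 F)) :
    Valued.v (α.1.2 p) * Valued.v ((α⁻¹).1.2 p) = 1 := by
  have h : α.1.2 p * (α⁻¹).1.2 p = 1 :=
    congrArg (fun a : AdeleRing (𝓞 F) F ↦ a.2 p) α.mul_inv
  rw [← map_mul, h, map_one]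

theorem mem_congruenceIdeles_iff [IsTotallyComplex F] {m : Ideal (𝓞 F)} {α : Ideles F} :
    α ∈ congruenceIdeles m ↔ ∀ p : HeightOneSpectrum (𝓞 F), Valued.v (α.1.2 p) = 1 ∧
      Valued.v (α.1.2 p - 1) ≤ WithZero.exp (-(multiplicity p.asIdeal m : ℤ)) :=
  ⟨fun h ↦ h.1, fun h ↦ ⟨h, fun v hv ↦ absurd (IsTotallyComplex.isComplex v)
    (InfinitePlace.not_isComplex_iff_isReal.2 hv)⟩⟩

/-- Integrality of both `α` and `α⁻¹` is an open condition making `α` a unit at every finite place.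
Beyond that, only the finitely many primes dividing `m` impose a condition. -/
theorem isOpen_congruenceIdeles [IsTotallyComplex F] {m : Ideal (𝓞 F)} (hm : m ≠ ⊥) :
    IsOpen (congruenceIdeles m : Set (Ideles F)) := by
  have hc1 : Continuous fun α : Ideles F ↦ α.1.2 := continuous_snd.comp Units.continuous_val
  have hc2 : Continuous fun α : Ideles F ↦ (α⁻¹).1.2 :=
    continuous_snd.comp Units.continuous_coe_inv
  have h := ((isOpen_forall_mem_integers (F := F)).preimage hc1).inter
    (((isOpen_forall_mem_integers (F := F)).preimage hc2).inter
    ((Ideal.finite_factors hm).isOpen_biInter fun p _ ↦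
      (isOpen_valued_sub_le p 1 (multiplicity p.asIdeal m)).preimage
        ((continuous_finiteAdele_apply p).comp hc1)))
  convert h using 1
  ext α
  rw [SetLike.mem_coe, mem_congruenceIdeles_iff]
  simp only [Set.mem_inter_iff, Set.mem_preimage, Set.mem_ofPred_eq, Set.mem_iInter,
    HeightOneSpectrum.mem_adicCompletionIntegers, Function.comp_apply]
  refine ⟨fun h ↦ ⟨fun p ↦ (h p).1.le, fun p ↦ ?_, fun p _ ↦ (h p).2⟩, fun h p ↦ ?_⟩
  · have := valued_finite_mul_inv α p
    rw [(h p).1, one_mul] at this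
    exact this.le
  · obtain ⟨h1, h2, h3⟩ := h
    refine ⟨le_antisymm (h1 p) ?_, ?_⟩
    · rw [← valued_finite_mul_inv α p]
      exact mul_le_of_le_one_right' (h2 p)
    · by_cases hp : p.asIdeal ∣ m
      · exact h3 p hp
      · rw [multiplicity_eq_zero.2 hp]
        simpa using Valuation.map_sub_le (v := Valued.v) (h1 p) (map_one Valued.v).le

/-- On the product of the local integer rings the adelic topology is the product topology, so a
neighbourhood of `1` constrains only finitely many primes, each modulo some power. -/
theorem exists_congruenceIdeles_subset {U : Set (Ideles F)} (hU : U ∈ 𝓝 (1 : Ideles F)) :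
    ∃ m : Ideal (𝓞 F), m ≠ ⊥ ∧ ∀ α ∈ congruenceIdeles m, α.1.1 = 1 → α ∈ U := by
  classical
  rw [Units.isInducing_embedProduct.nhds_eq_comap, Filter.mem_comap] at hU
  obtain ⟨W, hW, hWU⟩ := hU
  obtain ⟨W₁, hW₁, W₂, hW₂, hW⟩ := mem_nhds_prod_iff.1 hW
  have hW₂' : MulOpposite.op ⁻¹' W₂ ∈ 𝓝 (1 : AdeleRing (𝓞 F) F) :=
    MulOpposite.continuous_op.continuousAt.preimage_mem_nhds (by simpa using hW₂)
  obtain ⟨A, hA, B, hB, hAB⟩ := mem_nhds_prod_iff.1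
    (Filter.inter_mem hW₁ hW₂' : _ ∈ 𝓝 (1 : InfiniteAdeleRing F × FiniteAdeleRing (𝓞 F) F))
  let s := RestrictedProduct.structureMap
    (fun v : HeightOneSpectrum (𝓞 F) ↦ v.adicCompletion F)
    (fun v ↦ (v.adicCompletionIntegers F : Set (v.adicCompletion F))) Filter.cofinite
  have hs : Continuous s := RestrictedProduct.isEmbedding_structureMap.continuous
  let e : (v : HeightOneSpectrum (𝓞 F)) → (v.adicCompletionIntegers F : Set (v.adicCompletion F)) :=
    fun v ↦ ⟨1, one_mem _⟩
  have hB' : s ⁻¹' B ∈ 𝓝 e := hs.continuousAt.preimage_mem_nhds hB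
  rw [nhds_pi, Filter.mem_pi'] at hB'
  obtain ⟨I, t, ht, hIt⟩ := hB'
  have ht' : ∀ p, ∃ k : ℕ, ∀ x : p.adicCompletionIntegers F,
      Valued.v (x.1 - 1) ≤ WithZero.exp (-(k : ℤ)) → x ∈ t p := by
    intro p
    obtain ⟨u, hu, hut⟩ := (mem_nhds_subtype _ _ _).1 (ht p)
    obtain ⟨k, hk⟩ := exists_valued_sub_le_subset p hu
    exact ⟨k, fun x hx ↦ hut (hk hx)⟩
  choose k hk using ht'
  have hm : ∏ p ∈ I, p.asIdeal ^ k p ≠ ⊥ :=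
    Finset.prod_ne_zero_iff.2 fun p _ ↦ pow_ne_zero _ p.ne_bot
  have key : ∀ α ∈ congruenceIdeles (∏ p ∈ I, p.asIdeal ^ k p), α.1.1 = 1 →
      α.1 ∈ A ×ˢ B := by
    intro α hα h1
    have hα' : ∀ p, α.1.2 p ∈ p.adicCompletionIntegers F := fun p ↦ (hα.1 p).1.le
    refine ⟨?_, ?_⟩
    · rw [h1]; exact mem_of_mem_nhds hA
    · have h2 : α.1.2 = s (fun p ↦ ⟨α.1.2 p, hα' p⟩) := FiniteAdeleRing.ext _ fun _ ↦ rfl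
      rw [h2]
      refine hIt fun p hp ↦ hk p _ ((hα.1 p).2.trans ?_)
      rw [WithZero.exp_le_exp, neg_le_neg_iff, Nat.cast_le]
      refine FiniteMultiplicity.le_multiplicity_of_pow_dvd
        (FiniteMultiplicity.of_prime_left p.prime hm) (Finset.dvd_prod_of_mem _ hp)
  refine ⟨_, hm, fun α hα h1 ↦ hWU (hW ⟨(hAB (key α hα h1)).1, ?_⟩)⟩
  -- The topology on units constrains the inverse too; as the congruence set is a group, the same
  -- bound applies to `α⁻¹`.
  refine (hAB (key α⁻¹ (inv_mem hα) ?_)).2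
  have := congrArg (fun a : AdeleRing (𝓞 F) F ↦ a.1) α.mul_inv
  change α.1.1 * (α⁻¹).1.1 = 1 at this
  rwa [h1, one_mul] at this

/-- The infinite component of an idele. -/
noncomputable def infinitePart : Ideles F →* (InfiniteAdeleRing F)ˣ :=
  Units.map (MonoidHom.fst (InfiniteAdeleRing F) (FiniteAdeleRing (𝓞 F) F))

theorem continuous_infinitePart : Continuous (infinitePart (F := F)) :=
  Continuous.units_map _ continuous_fst

theorem infinitePart_infiniteIdele (x : (InfiniteAdeleRing F)ˣ) :
    infinitePart (infiniteIdele F x) = x := rfl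

theorem infiniteIdele_mem_congruenceIdeles [IsTotallyComplex F] (m : Ideal (𝓞 F))
    (x : (InfiniteAdeleRing F)ˣ) : infiniteIdele F x ∈ congruenceIdeles m := by
  rw [mem_congruenceIdeles_iff]
  intro p
  have h : (infiniteIdele F x).1.2 p = 1 := rfl
  simp [h]

/-- A homomorphism is continuous once it is continuous at `1`, hence once it is so on an open
subgroup. All Hecke characters constructed from ideles below get their continuity here. -/
theorem continuous_of_eq_on_congruenceIdeles [IsTotallyComplex F] {m : Ideal (𝓞 F)} (hm : m ≠ ⊥)
    {f : Ideles F →* ℂˣ} {g : (InfiniteAdeleRing F)ˣ →* ℂˣ} (hg : Continuous g)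
    (h : ∀ α ∈ congruenceIdeles m, f α = g (infinitePart α)) : Continuous f := by
  refine continuous_of_continuousAt_one f ?_
  refine ((hg.comp continuous_infinitePart).continuousAt (x := 1)).congr ?_
  filter_upwards [(isOpen_congruenceIdeles hm).mem_nhds (one_mem _)] with α hα
  exact (h α hα).symm

/-- The Hecke character defined by a character of the ideles trivial on principal ideles. -/
noncomputable def heckeCharacterOfIdeles (f : Ideles F →* ℂˣ) (hf : Continuous f)
    (hP : ∀ x : Fˣ, f (Units.map (algebraMap F (AdeleRing (𝓞 F) F) : F →* _) x) = 1) :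
    HeckeCharacter F where
  toMonoidHom := QuotientGroup.lift (principalIdeles F) f (by rintro _ ⟨x, rfl⟩; exact hP x)
  continuous_toFun := continuous_quot_lift _ hf

theorem heckeCharacterOfIdeles_mk (f : Ideles F →* ℂˣ) (hf : Continuous f)
    (hP : ∀ x : Fˣ, f (Units.map (algebraMap F (AdeleRing (𝓞 F) F) : F →* _) x) = 1)
    (α : Ideles F) : heckeCharacterOfIdeles f hf hP (QuotientGroup.mk α) = f α := rfl

end IdeleTopology

/-! ### Hecke characters trivial at infinity -/

section Dirichlet
variable {F : Type*} [Field F] [NumberField F]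

open Topology

/-- While the powers of `z` stay within 1/2 of `1`, each squaring multiplies the distance to `1` by
at least 3/2, which cannot go on unless `z = 1`. -/
theorem exists_nhds_one_noSmallSubgroup :
    ∃ V ∈ 𝓝 (1 : ℂˣ), ∀ z : ℂˣ, (∀ n : ℕ, z ^ n ∈ V) → z = 1 := by
  refine ⟨{z | ‖(z : ℂ) - 1‖ < 1 / 2}, ?_, fun z hz ↦ ?_⟩
  · refine (isOpen_lt (by fun_prop) continuous_const).mem_nhds (by simp)
  · by_contra hne
    have hpos : 0 < ‖(z : ℂ) - 1‖ := by
      rw [norm_pos_iff, sub_ne_zero]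
      exact fun h ↦ hne (Units.ext h)
    have hz' : ∀ n : ℕ, ‖(z : ℂ) ^ n - 1‖ < 1 / 2 := fun n ↦ by simpa using hz n
    have key : ∀ k : ℕ, (3 / 2 : ℝ) ^ k * ‖(z : ℂ) - 1‖ ≤ ‖(z : ℂ) ^ 2 ^ k - 1‖ := by
      intro k
      induction k with
      | zero => simp
      | succ k ih =>
        have h1 : (z : ℂ) ^ 2 ^ (k + 1) - 1 = ((z : ℂ) ^ 2 ^ k + 1) * ((z : ℂ) ^ 2 ^ k - 1) := by
          ring
        have h2 : 3 / 2 ≤ ‖(z : ℂ) ^ 2 ^ k + 1‖ := by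
          have h3 : ‖(2 : ℂ)‖ ≤ ‖(z : ℂ) ^ 2 ^ k + 1‖ + ‖(z : ℂ) ^ 2 ^ k - 1‖ := by
            refine le_trans (le_of_eq ?_) (norm_sub_le _ _)
            ring_nf
          have h4 := hz' (2 ^ k)
          rw [Complex.norm_ofNat] at h3
          linarith
        rw [h1, norm_mul, pow_succ', mul_assoc]
        exact mul_le_mul h2 ih (by positivity) (by positivity)
    obtain ⟨k, hk⟩ := pow_unbounded_of_one_lt (1 / ‖(z : ℂ) - 1‖) (by norm_num : (1 : ℝ) < 3 / 2)
    rw [div_lt_iff₀ hpos] at hk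
    linarith [key k, hz' (2 ^ k)]

/-- The class number makes an idele a unit at all finite places up to a principal one; a further
power, from the primes dividing `m`, makes that unit congruent to `1`. This weak form of finiteness
of ray class groups suffices for finite order. -/
theorem exists_pow_mem_congruenceIdeles [IsTotallyComplex F] {m : Ideal (𝓞 F)} (hm : m ≠ ⊥) :
    ∃ N : ℕ, 0 < N ∧ ∀ α : Ideles F, α ^ N ∈ congruenceIdeles m ⊔ principalIdeles F := by
  classical
  choose N hN hN' using fun p : HeightOneSpectrum (𝓞 F) ↦
    exists_pow_valued_sub_one_le p (multiplicity p.asIdeal m)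
  let S := (Ideal.finite_factors hm).toFinset
  refine ⟨Nat.card (ClassGroup (𝓞 F)) * ∏ p ∈ S, N p,
    mul_pos Nat.card_pos (Finset.prod_pos fun p _ ↦ hN p), fun α ↦ ?_⟩
  obtain ⟨x, hx⟩ := exists_valuation_eq_pow_classNumber α
  let ι : Fˣ →* Ideles F := Units.map (algebraMap F (AdeleRing (𝓞 F) F) : F →* _)
  let β := α ^ Nat.card (ClassGroup (𝓞 F)) * (ι x)⁻¹
  have hβ : ∀ p, Valued.v (β.1.2 p) = 1 := by
    intro p
    have h1 : β * ι x = α ^ Nat.card (ClassGroup (𝓞 F)) := inv_mul_cancel_right _ _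
    have h2 : β.1.2 p * algebraMap F (p.adicCompletion F) x =
        (α.1.2 p) ^ Nat.card (ClassGroup (𝓞 F)) :=
      congrArg (fun a : Ideles F ↦ a.1.2 p) h1
    have h3 := congrArg Valued.v h2
    rw [map_mul, valued_algebraMap, hx, map_pow] at h3
    refine mul_right_cancel₀ (pow_ne_zero _ ?_) (h3.trans (one_mul _).symm)
    exact left_ne_zero_of_mul_eq_one (valued_finite_mul_inv α p)
  have hβN : β ^ ∏ p ∈ S, N p ∈ congruenceIdeles m := by
    rw [mem_congruenceIdeles_iff]
    intro p
    have h1 : (β ^ ∏ p ∈ S, N p).1.2 p = (β.1.2 p) ^ ∏ p ∈ S, N p := rfl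
    rw [h1]
    refine ⟨by rw [map_pow, hβ, one_pow], ?_⟩
    by_cases hp : p.asIdeal ∣ m
    · have hpS : p ∈ S := by simpa [S] using hp
      rw [← Finset.mul_prod_erase _ _ hpS, pow_mul]
      have h2 := valued_pow_sub_pow_le p (a := (β.1.2 p) ^ N p) (b := 1)
        (by rw [map_pow, hβ, one_pow]) (map_one _).le (∏ q ∈ S.erase p, N q)
      rw [one_pow] at h2
      exact h2.trans (hN' p _ (hβ p))
    · rw [multiplicity_eq_zero.2 hp]
      simpa using Valuation.map_sub_le (v := Valued.v) (by rw [map_pow, hβ, one_pow] :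
        Valued.v ((β.1.2 p) ^ ∏ p ∈ S, N p) ≤ 1) (map_one Valued.v).le
  have h4 : α ^ (Nat.card (ClassGroup (𝓞 F)) * ∏ p ∈ S, N p) =
      β ^ (∏ p ∈ S, N p) * (ι x) ^ ∏ p ∈ S, N p := by
    rw [← mul_pow, inv_mul_cancel_right, pow_mul]
  rw [h4]
  exact mul_mem (Subgroup.mem_sup_left hβN)
    (Subgroup.mem_sup_right (pow_mem (MonoidHom.mem_range.2 ⟨x, rfl⟩) _))

/-- A Hecke character of a totally complex field that is trivial at infinity is a Dirichlet
character, and has finite order. -/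
theorem isDirichletCharacter_of_trivial [IsTotallyComplex F] (χ : HeckeCharacter F)
    (hχ : ∀ x, χ (QuotientGroup.mk (infiniteIdele F x)) = 1) :
    IsDirichletCharacter χ ∧ IsOfFinOrder χ := by
  obtain ⟨V, hV, hV'⟩ := exists_nhds_one_noSmallSubgroup
  let f : Ideles F →* ℂˣ := χ.toMonoidHom.comp (QuotientGroup.mk' (principalIdeles F))
  have hf : Continuous f := χ.continuous_toFun.comp continuous_quotient_mk'
  obtain ⟨m, hm, hmV⟩ := exists_congruenceIdeles_subset
    (hf.continuousAt.preimage_mem_nhds (by rwa [map_one]) : f ⁻¹' V ∈ 𝓝 1)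
  -- Strip off the infinite component, where `f` is trivial. All powers of the rest remain in the
  -- chosen neighbourhood, so their images remain in `V`, which forces the image to be `1`.
  have h1 : ∀ α ∈ congruenceIdeles m, f α = 1 := by
    intro α hα
    have h2 : α = infiniteIdele F (infinitePart α) *
        (α * (infiniteIdele F (infinitePart α))⁻¹) := by
      rw [mul_comm α, mul_inv_cancel_left]
    rw [h2, map_mul, show f (infiniteIdele F (infinitePart α)) = 1 from hχ _, one_mul]
    have h3 : α * (infiniteIdele F (infinitePart α))⁻¹ ∈ congruenceIdeles m :=
      mul_mem hα (inv_mem (infiniteIdele_mem_congruenceIdeles m _))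
    have h4 : infinitePart (α * (infiniteIdele F (infinitePart α))⁻¹) = 1 := by
      rw [map_mul, map_inv, infinitePart_infiniteIdele, mul_inv_cancel]
    refine hV' _ fun n ↦ ?_
    rw [← map_pow]
    refine hmV _ (pow_mem h3 n) ?_
    have h5 : infinitePart ((α * (infiniteIdele F (infinitePart α))⁻¹) ^ n) = 1 := by
      rw [map_pow, h4, one_pow]
    exact congrArg Units.val h5
  have hker : congruenceIdeles m ⊔ principalIdeles F ≤ f.ker := by
    refine sup_le (fun α hα ↦ h1 α hα) ?_
    intro α hα
    have : (QuotientGroup.mk α : IdeleClassGroup F) = 1 := (QuotientGroup.eq_one_iff α).2 hα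
    change χ (QuotientGroup.mk α) = 1
    rw [this, map_one]
  obtain ⟨N, hN, hN'⟩ := exists_pow_mem_congruenceIdeles hm
  have hfN : ∀ α, f α ^ N = 1 := fun α ↦ by
    rw [← map_pow]; exact hker (hN' α)
  refine ⟨⟨m, hm, ?_⟩, ?_⟩
  · let g : NarrowRayClassGroup m →* ℂˣ := QuotientGroup.lift _ f hker
    have hg : ∀ x, ‖(g x : ℂ)‖ = 1 := by
      intro x
      obtain ⟨α, rfl⟩ := QuotientGroup.mk_surjective x
      refine Complex.norm_eq_one_of_pow_eq_one (n := N) ?_ hN.ne'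
      rw [← Units.val_pow_eq_pow_val]
      exact congrArg Units.val (hfN α)
    refine ⟨{ toFun x := ⟨g x, by simp [Submonoid.unitSphere, hg x]⟩
              map_one' := Subtype.ext (by simp)
              map_mul' x y := Subtype.ext (congrArg Units.val (map_mul g x y)) }, fun α ↦ rfl⟩
  · rw [isOfFinOrder_iff_pow_eq_one]
    refine ⟨N, hN, ?_⟩
    refine ContinuousMonoidHom.ext fun x ↦ ?_
    obtain ⟨α, rfl⟩ := QuotientGroup.mk_surjective x
    rw [ContinuousMonoidHom.pow_apply]
    exact hfN α

end Dirichlet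

/-! ### Norms on finite products of algebras -/

section NormPi

/-- Multiplication by `x` is block diagonal in the product basis. The order put on `ι` is arbitrary
and serves only the block-triangular determinant formula. -/
theorem norm_pi_apply {R ι : Type*} [Field R] [Fintype ι] {A : ι → Type*} [∀ i, CommRing (A i)]
    [∀ i, Algebra R (A i)] [∀ i, FiniteDimensional R (A i)] (x : ∀ i, A i) :
    Algebra.norm R x = ∏ i, Algebra.norm R (x i) := by
  classical
  let b := fun i ↦ Module.finBasis R (A i)
  let _ : LinearOrder ι := LinearOrder.lift' (Fintype.equivFin ι) (Fintype.equivFin ι).injective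
  have hM : ∀ s t, Algebra.leftMulMatrix (Pi.basis b) x s t =
      (b s.1).repr (x s.1 * Pi.single (M := A) t.1 (b t.1 t.2) s.1) s.2 := fun s t ↦ by
    rw [Algebra.leftMulMatrix_eq_repr_mul, Pi.basis_repr, Pi.basis_apply, Pi.mul_apply]
  have h : (Algebra.leftMulMatrix (Pi.basis b) x).BlockTriangular Sigma.fst := by
    rintro s t hst
    rw [hM, Pi.single_eq_of_ne hst.ne', mul_zero, map_zero, Finsupp.zero_apply]
  rw [Algebra.norm_eq_matrix_det (Pi.basis b), h.det_fintype]
  refine Finset.prod_congr rfl fun k _ ↦ ?_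
  rw [Algebra.norm_eq_matrix_det (b k), ← Matrix.det_submatrix_equiv_self (Equiv.sigmaSubtype k).symm]
  congr 1
  ext i j
  rw [Matrix.submatrix_apply, Matrix.toSquareBlock_def, Algebra.leftMulMatrix_eq_repr_mul]
  refine (hM ⟨k, i⟩ ⟨k, j⟩).trans ?_
  rw [Pi.single_eq_same]

end NormPi

/-! ### Traces of elements integral above a prime -/

section Trace
variable {K L : Type*} [Field K] [Field L] [NumberField L] [Algebra K L]
  (v : HeightOneSpectrum (𝓞 K))

theorem exists_mem_notMem_of_not_liesOver (w : HeightOneSpectrum (𝓞 L))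
    (h : ¬ w.asIdeal.LiesOver v.asIdeal) :
    ∃ s : 𝓞 K, s ∉ v.asIdeal ∧ algebraMap (𝓞 K) (𝓞 L) s ∈ w.asIdeal := by
  by_contra! hcon
  refine h ⟨?_⟩
  have := w.isMaximal
  exact ((Ideal.IsMaximal.under (𝓞 K) w.asIdeal).eq_of_le v.isPrime.ne_top
    fun s hs ↦ by_contra fun hsv ↦ hcon s hsv hs).symm

/-- An element of `L` that is integral above `v` is integral up to an integer prime to `v`. -/
theorem exists_smul_isIntegral (y : L)
    (hy : ∀ w : HeightOneSpectrum (𝓞 L), w.asIdeal.LiesOver v.asIdeal → w.valuation L y ≤ 1) :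
    ∃ s : 𝓞 K, s ∉ v.asIdeal ∧ ∃ z : 𝓞 L, (z : L) = (s : K) • y := by
  classical
  have hfin := HeightOneSpectrum.Support.finite (𝓞 L) y
  have hs : ∀ w : HeightOneSpectrum (𝓞 L), ∃ s : 𝓞 K, s ∉ v.asIdeal ∧
      (1 < w.valuation L y → w.valuation L (algebraMap K L s) * w.valuation L y ≤ 1) := by
    intro w
    by_cases h : w.asIdeal.LiesOver v.asIdeal
    · exact ⟨1, v.isPrime.one_notMem, fun h1 ↦ absurd (hy w h) h1.not_ge⟩
    · obtain ⟨s, hsv, hsw⟩ := exists_mem_notMem_of_not_liesOver v w h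
      have hw : w.valuation L (algebraMap K L s) ≤ WithZero.exp (-1) := by
        have h1 : algebraMap K L s = algebraMap (𝓞 L) L (algebraMap (𝓞 K) (𝓞 L) s) := rfl
        rw [h1, HeightOneSpectrum.valuation_of_algebraMap]
        have := (w.intValuation_le_pow_iff_mem (algebraMap (𝓞 K) (𝓞 L) s) 1).2 (by simpa using hsw)
        simpa using this
      -- The pole order of `y` at `w`; each factor `s` removes at least one from it.
      refine ⟨s ^ (WithZero.log (w.valuation L y)).toNat,
        fun h ↦ hsv (v.isPrime.mem_of_pow_mem _ h), fun h1 ↦ ?_⟩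
      have hy0 : w.valuation L y ≠ 0 := (zero_lt_one.trans h1).ne'
      have h2 : algebraMap K L ((s ^ (WithZero.log (w.valuation L y)).toNat : 𝓞 K) : K) =
        algebraMap K L (s : K) ^ (WithZero.log (w.valuation L y)).toNat := by simp
      rw [h2, map_pow]
      refine (mul_le_mul_left (pow_le_pow_left₀ zero_le hw _) _).trans ?_
      conv_lhs => rw [← WithZero.exp_log hy0]
      rw [WithZero.log_exp, ← WithZero.exp_nsmul, ← WithZero.exp_add, ← WithZero.exp_zero,
        WithZero.exp_le_exp]
      have := Int.self_le_toNat (WithZero.log (w.valuation L y))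
      simp only [smul_neg, nsmul_eq_mul, mul_one]
      omega
  choose s hsv hsw using hs
  refine ⟨∏ w ∈ hfin.toFinset, s w, ?_, ?_⟩
  · intro h
    obtain ⟨w, -, hw⟩ := (Ideal.IsPrime.prod_mem_iff (hp := v.isPrime)).1 h
    exact hsv w hw
  · refine HeightOneSpectrum.mem_integers_of_valuation_le_one L _ fun w ↦ ?_
    have hint : ∀ t : 𝓞 K, w.valuation L (algebraMap K L t) ≤ 1 := fun t ↦
      w.valuation_le_one (algebraMap (𝓞 K) (𝓞 L) t)
    rw [Algebra.smul_def, map_mul]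
    by_cases h1 : 1 < w.valuation L y
    · have hwS : w ∈ hfin.toFinset := by simpa [HeightOneSpectrum.Support] using h1
      rw [← Finset.prod_erase_mul _ _ hwS]
      have h2 : algebraMap K L (((∏ x ∈ hfin.toFinset.erase w, s x) * s w : 𝓞 K) : K) =
          algebraMap K L ((∏ x ∈ hfin.toFinset.erase w, s x : 𝓞 K) : K) *
            algebraMap K L (s w : K) := by
        rw [← map_mul]; rfl
      rw [h2, map_mul, mul_assoc]
      exact mul_le_one' (hint _) (hsw w h1)
    · exact mul_le_one' (hint _) (not_lt.1 h1)

variable [NumberField K]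

/-- After multiplication by an integer of `K` prime to `v`, the element is integral everywhere and
so is its trace; that factor is invisible to `v`. -/
theorem valuation_trace_le_one (y : L)
    (hy : ∀ w : HeightOneSpectrum (𝓞 L), w.asIdeal.LiesOver v.asIdeal → w.valuation L y ≤ 1) :
    v.valuation K (Algebra.trace K L y) ≤ 1 := by
  obtain ⟨s, hs, z, hz⟩ := exists_smul_isIntegral v y hy
  have h1 : Algebra.trace K L (z : L) = (s : K) * Algebra.trace K L y := by
    rw [hz, map_smul, smul_eq_mul]
  obtain ⟨t, ht⟩ := (IsIntegrallyClosed.isIntegral_iff (R := 𝓞 K)).1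
    (Algebra.isIntegral_trace (L := K) (R := 𝓞 K) (x := (z : L))
      ((RingOfIntegers.isIntegral_coe z).tower_top))
  have h2 := congrArg (v.valuation K) (ht.trans h1)
  rw [map_mul, show v.valuation K (s : K) = 1 from
    (HeightOneSpectrum.valuation_eq_one_iff_notMem (K := K) v).2 hs, one_mul] at h2
  rw [← h2]
  exact v.valuation_le_one t

end Trace

/-! ### Weak approximation at finite places -/

section WeakApproximation
variable {L : Type*} [Field L] [NumberField L]

theorem denseRange_algebraMap_pi_adicCompletion (W : Type*) [Finite W]
    (q : W → HeightOneSpectrum (𝓞 L)) (hq : Function.Injective q) :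
    DenseRange fun (x : L) (w : W) ↦ algebraMap L ((q w).adicCompletion L) x := by
  let a : W → AbsoluteValue L ℝ := fun w ↦ HeightOneSpectrum.adicAbv L (q w)
  have h1 : ∀ w, (a w).IsNontrivial := by
    intro w
    obtain ⟨x, hx, hx0⟩ := Submodule.exists_mem_ne_zero_of_ne_bot (q w).ne_bot
    refine ⟨(x : L), by simpa using hx0, ne_of_lt ?_⟩
    exact ((q w).adicAbv_coe_lt_one_iff (HeightOneSpectrum.one_lt_absNorm_nnreal (q w)) x).2 hx
  have h2 : Pairwise fun i j ↦ ¬ (a i).IsEquiv (a j) := by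
    intro i j hij h
    refine hij (hq (HeightOneSpectrum.ext (Ideal.ext fun x ↦ ?_)))
    rw [← (q i).adicAbv_coe_lt_one_iff (K := L) (HeightOneSpectrum.one_lt_absNorm_nnreal (q i)) x,
      ← (q j).adicAbv_coe_lt_one_iff (K := L) (HeightOneSpectrum.one_lt_absNorm_nnreal (q j)) x]
    exact h.lt_one_iff
  have h3 : ∀ w, Isometry ((algebraMap L ((q w).adicCompletion L)).comp
      (WithAbs.equiv (a w)).toRingHom) := fun w ↦
    AddMonoidHomClass.isometry_of_norm _ fun x ↦
      FinitePlace.norm_embedding (K := L) (q w) (WithAbs.equiv (a w) x)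
  have h4 : ∀ w, DenseRange ((algebraMap L ((q w).adicCompletion L)).comp
      (WithAbs.equiv (a w)).toRingHom) := fun w ↦ by
    have := HeightOneSpectrum.denseRange_algebraMap L (q w)
    rwa [DenseRange, ← (WithAbs.equiv (a w)).surjective.range_comp] at this
  exact (DenseRange.piMap h4).comp (AbsoluteValue.denseRange_algebraMap_pi h1 h2)
    (.piMap fun w ↦ (h3 w).continuous)

end WeakApproximation

/-! ### The global norm as a product of local norms -/

section LocalGlobal
variable (K L : Type*) [Field K] [NumberField K] [Field L] [NumberField L] [Algebra K L]
  (v : HeightOneSpectrum (𝓞 K))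

/-- This is `K_v ⊗ L ≅ ∏ L_w` in coordinates: a `K`-basis of `L` stays a `K_v`-basis of the product
of the completions, so multiplication by `x` has the same matrix on both sides. -/
theorem prod_finiteLocalNorm_algebraMap (x : L) :
    ∏ᶠ w : {w : HeightOneSpectrum (𝓞 L) // w.asIdeal.LiesOver v.asIdeal},
      (haveI := w.2
      finiteLocalNorm K L v w.1 (algebraMap L _ x)) = algebraMap K _ (Algebra.norm K x) := by
  classical
  let W := {w : HeightOneSpectrum (𝓞 L) // w.asIdeal.LiesOver v.asIdeal}
  let _ : Fintype W := Fintype.ofFinite W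
  have hW : ∀ w : W, w.1.asIdeal.LiesOver v.asIdeal := fun w ↦ w.2
  let Kv := v.adicCompletion K
  let A : W → Type _ := fun w ↦ w.1.adicCompletion L
  let _ : NontriviallyNormedField Kv := Valued.toNontriviallyNormedField _ ℤᵐ⁰
  let _ : ∀ w : W, Algebra Kv (A w) := fun w ↦ (finiteCompletionMap K L v w.1).toAlgebra
  have hsmul : ∀ w : W, ContinuousSMul Kv (A w) := fun w ↦
    ⟨((continuous_finiteCompletionMap v w.1).comp continuous_fst).mul continuous_snd⟩
  have htower : ∀ w : W, IsScalarTower K Kv (A w) := fun w ↦ .of_algebraMap_eq fun x ↦ by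
    rw [RingHom.algebraMap_toAlgebra, finiteCompletionMap_algebraMap,
      ← IsScalarTower.algebraMap_apply]
  have hfd : ∀ w : W, FiniteDimensional Kv (A w) := fun w ↦ inferInstance
  let b := Module.finBasis K L
  let c : Fin (Module.finrank K L) → (∀ w : W, A w) := fun i w ↦ algebraMap L (w.1.adicCompletion L) (b i)
  have hc : ∀ (β : Fin (Module.finrank K L) → K) (w : W), (∑ i, algebraMap K Kv (β i) • c i) w =
      algebraMap L (w.1.adicCompletion L) (∑ i, β i • b i) := by
    intro β w
    rw [Finset.sum_apply, map_sum]
    refine Finset.sum_congr rfl fun i _ ↦ ?_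
    rw [Pi.smul_apply, algebraMap_smul, Algebra.smul_def, Algebra.smul_def, map_mul]
    rfl
  -- Given a relation with coefficients `a`, approximate them by `β` in `K`. Then `y = ∑ β_j b_j` is
  -- small at every `w` above `v`, so `β_i = Tr(y * b_i^*)`, with `b_i^*` the trace-dual basis, is
  -- divisible by `π ^ k`, and hence so is `a_i`, for every `k`.
  have hli : LinearIndependent Kv c := by
    rw [Fintype.linearIndependent_iff]
    intro a ha
    have key : ∀ (k : ℕ) i, Valued.v (a i) ≤ WithZero.exp (-(k : ℤ)) := by
      intro k
      obtain ⟨π, hπ⟩ := v.valuation_exists_uniformizer K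
      have hπ0 : π ≠ 0 := by
        rintro rfl
        exact WithZero.exp_ne_zero (hπ.symm.trans (map_zero _))
      let g : (Fin (Module.finrank K L) → Kv) → ∀ w : W, A w := fun a' ↦ ∑ i, a' i • c i
      have hg : Continuous g := by fun_prop
      -- The threshold at `w` is the size of `π ^ k` there, which takes ramification into account.
      let l : W → ℤ := fun w ↦ WithZero.log (w.1.valuation L (algebraMap K L (π ^ k)))
      have hl : ∀ w : W, WithZero.exp (l w) = w.1.valuation L (algebraMap K L (π ^ k)) := fun w ↦
        WithZero.exp_log ((Valuation.ne_zero_iff _).2 (by simpa using pow_ne_zero k hπ0))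
      let U₁ : Set (Fin (Module.finrank K L) → Kv) :=
        ⋂ i, (fun a' ↦ a' i) ⁻¹' {t | Valued.v (t - a i) ≤ WithZero.exp (-(k : ℤ))}
      let U₂ : Set (Fin (Module.finrank K L) → Kv) :=
        ⋂ (w : W), ⋂ i, (fun a' ↦ g a' w * algebraMap L (w.1.adicCompletion L) (b.traceDual i)) ⁻¹'
          {t | Valued.v (t - 0) ≤ WithZero.exp (-(-l w))}
      have hU₁ : IsOpen U₁ := isOpen_iInter_of_finite fun i ↦
        (isOpen_valued_sub_le v (a i) k).preimage (continuous_apply i)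
      have hU₂ : IsOpen U₂ := isOpen_iInter_of_finite fun w ↦ isOpen_iInter_of_finite fun i ↦
        (isOpen_valued_sub_le w.1 0 _).preimage
          (((continuous_apply w).comp hg).mul continuous_const)
      have haU : a ∈ U₁ ∩ U₂ := by
        refine ⟨Set.mem_iInter.2 fun i ↦ ?_, Set.mem_iInter.2 fun w ↦ Set.mem_iInter.2 fun i ↦ ?_⟩
        · simp
        · have : g a w = 0 := congrFun ha w
          simp [this]
      obtain ⟨β, hβ⟩ := (DenseRange.piMap fun _ : Fin (Module.finrank K L) ↦
        v.denseRange_algebraMap K).exists_mem_open (hU₁.inter hU₂) ⟨a, haU⟩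
      intro i
      have h1 : Valued.v (algebraMap K Kv (β i) - a i) ≤ WithZero.exp (-(k : ℤ)) :=
        Set.mem_iInter.1 hβ.1 i
      have h2 : v.valuation K (Algebra.trace K L
          ((π ^ k)⁻¹ • ((∑ j, β j • b j) * b.traceDual i))) ≤ 1 := by
        refine valuation_trace_le_one v _ fun w hw ↦ ?_
        have h3 := Set.mem_iInter.1 (Set.mem_iInter.1 hβ.2 ⟨w, hw⟩) i
        change Valued.v (g (fun i ↦ algebraMap K Kv (β i)) ⟨w, hw⟩ *
          algebraMap L (w.adicCompletion L) (b.traceDual i) - 0) ≤ _ at h3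
        have h3' : g (fun i ↦ algebraMap K Kv (β i)) ⟨w, hw⟩ =
          algebraMap L (w.adicCompletion L) (∑ i, β i • b i) := hc β ⟨w, hw⟩
        rw [sub_zero, neg_neg, hl, h3', ← map_mul, valued_algebraMap] at h3
        rw [Algebra.smul_def, map_mul, map_inv₀, map_inv₀]
        exact inv_mul_le_one_of_le₀ h3 zero_le
      have h4 : Algebra.trace K L ((∑ j, β j • b j) * b.traceDual i) = β i := by
        rw [Finset.sum_mul, map_sum, Finset.sum_eq_single i]
        · rw [smul_mul_assoc, map_smul, b.trace_mul_traceDual]; simp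
        · intro j _ hj
          rw [smul_mul_assoc, map_smul, b.trace_mul_traceDual]; simp [hj]
        · simp
      rw [map_smul, h4, smul_eq_mul, map_mul, map_inv₀, map_pow, hπ] at h2
      have h5 : Valued.v (algebraMap K Kv (β i)) ≤ WithZero.exp (-(k : ℤ)) := by
        rw [valued_algebraMap]
        refine ((inv_mul_le_one₀ (by simp)).1 h2).trans_eq ?_
        rw [← WithZero.exp_nsmul]
        simp
      rw [← sub_sub_cancel (algebraMap K Kv (β i)) (a i)]
      exact Valuation.map_sub_le (v := Valued.v) h5 h1
    intro i
    by_contra hai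
    have h1 := key (1 - WithZero.log (Valued.v (a i))).toNat i
    have h2 : (Valued.v (a i) : ℤᵐ⁰) ≠ 0 := (Valuation.ne_zero_iff _).2 hai
    rw [← WithZero.log_le_iff_le_exp h2] at h1
    have := Int.self_le_toNat (1 - WithZero.log (Valued.v (a i)))
    omega
  -- The span is closed, being finite-dimensional over a complete field, and it contains the image
  -- of `L`, which is dense by weak approximation.
  have hspan : ⊤ ≤ Submodule.span Kv (Set.range c) := by
    have hcl : IsClosed (Submodule.span Kv (Set.range c) : Set (∀ w : W, A w)) :=
      Submodule.closed_of_finiteDimensional _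
    intro z _
    have hz := denseRange_algebraMap_pi_adicCompletion W (fun w ↦ w.1) Subtype.val_injective z
    refine hcl.closure_subset_iff.2 ?_ hz
    rintro _ ⟨y, rfl⟩
    have : (fun w : W ↦ algebraMap L (w.1.adicCompletion L) y) =
        ∑ i, algebraMap K Kv (b.repr y i) • c i := by
      ext w
      rw [hc, b.sum_repr]
    refine Set.mem_of_eq_of_mem this ?_
    exact Submodule.sum_mem _ fun i _ ↦ Submodule.smul_mem _ _ (Submodule.subset_span ⟨i, rfl⟩)
  let B := Module.Basis.mk hli hspan
  have h1 : algebraMap K Kv (Algebra.norm K x) =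
      Algebra.norm Kv (fun w : W ↦ (algebraMap L (w.1.adicCompletion L) x : A w)) := by
    rw [Algebra.norm_eq_matrix_det b, Algebra.norm_eq_matrix_det B, RingHom.map_det]
    congr 1
    ext i j
    rw [RingHom.mapMatrix_apply, Matrix.map_apply, Algebra.leftMulMatrix_eq_repr_mul,
      Algebra.leftMulMatrix_eq_repr_mul]
    have h2 : (fun w : W ↦ (algebraMap L (w.1.adicCompletion L) x : A w)) * B j =
        ∑ i, algebraMap K Kv (b.repr (x * b j) i) • B i := by
      ext w
      simp only [B, Module.Basis.mk_apply]
      rw [hc, b.sum_repr, map_mul]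
      rfl
    rw [h2, B.repr_sum_self]
  rw [h1, norm_pi_apply, finprod_eq_prod_of_fintype]
  rfl

end LocalGlobal

/-! ### The idele norm on principal ideles and congruence groups -/

section IdeleNorm
variable {K L : Type*} [Field K] [NumberField K] [Field L] [NumberField L] [Algebra K L]

/-- The principal idele of a nonzero element. -/
noncomputable def principalIdele {F : Type*} [Field F] [NumberField F] : Fˣ →* Ideles F :=
  Units.map (algebraMap F (AdeleRing (𝓞 F) F) : F →* AdeleRing (𝓞 F) F)

theorem ideleNorm_principalIdele [IsTotallyComplex K] (x : Lˣ) :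
    ideleNorm K L (principalIdele x) = principalIdele (Units.map (Algebra.norm K) x) := by
  refine Units.ext (Prod.ext ?_ ?_)
  · exact infiniteAdeleNorm_algebraMap (K := K) (x : L)
  · exact FiniteAdeleRing.ext _ fun v ↦ prod_finiteLocalNorm_algebraMap K L v (x : L)

theorem infinitePart_ideleNorm (α : Ideles L) :
    infinitePart (ideleNorm K L α) = Units.map (infiniteAdeleNorm K L) (infinitePart α) := rfl

theorem ideleNorm_infiniteIdele (x : (InfiniteAdeleRing L)ˣ) :
    ideleNorm K L (infiniteIdele L x) = infiniteIdele K (Units.map (infiniteAdeleNorm K L) x) :=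
  Units.ext (Prod.ext rfl (map_one (finiteAdeleNorm K L)))

theorem continuous_finiteLocalNorm (v : HeightOneSpectrum (𝓞 K)) (w : HeightOneSpectrum (𝓞 L))
    [w.asIdeal.LiesOver v.asIdeal] : Continuous (finiteLocalNorm K L v w) := by
  let _ := (finiteCompletionMap K L v w).toAlgebra
  let _ : NontriviallyNormedField (v.adicCompletion K) := Valued.toNontriviallyNormedField _ ℤᵐ⁰
  have : ContinuousSMul (v.adicCompletion K) (w.adicCompletion L) :=
    ⟨((continuous_finiteCompletionMap v w).comp continuous_fst).mul continuous_snd⟩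
  have : IsScalarTower K (v.adicCompletion K) (w.adicCompletion L) := .of_algebraMap_eq fun x ↦ by
    rw [RingHom.algebraMap_toAlgebra, finiteCompletionMap_algebraMap,
      ← IsScalarTower.algebraMap_apply]
  let b := Module.finBasis (v.adicCompletion K) (w.adicCompletion L)
  have : ∀ y, finiteLocalNorm K L v w y = (Algebra.leftMulMatrix b y).det :=
    fun y ↦ Algebra.norm_eq_matrix_det b y
  simp_rw [funext this]
  exact Continuous.matrix_det
    (LinearMap.continuous_of_finiteDimensional (Algebra.leftMulMatrix b).toLinearMap)

theorem valued_finiteLocalNorm_eq_one (v : HeightOneSpectrum (𝓞 K))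
    (w : HeightOneSpectrum (𝓞 L)) [w.asIdeal.LiesOver v.asIdeal] {x : w.adicCompletion L}
    (hx : Valued.v x = 1) : Valued.v (finiteLocalNorm K L v w x) = 1 := by
  have hx0 : x ≠ 0 := by
    rintro rfl
    exact zero_ne_one ((map_zero Valued.v).symm.trans hx)
  have h1 : Valued.v (finiteLocalNorm K L v w x) ≤ 1 := finiteLocalNorm_mem v w hx.le
  have h2 : Valued.v (finiteLocalNorm K L v w x⁻¹) ≤ 1 :=
    finiteLocalNorm_mem v w (show Valued.v x⁻¹ ≤ 1 by rw [map_inv₀, hx, inv_one])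
  have h3 : Valued.v (finiteLocalNorm K L v w x) * Valued.v (finiteLocalNorm K L v w x⁻¹) = 1 := by
    rw [← map_mul, ← map_mul, mul_inv_cancel₀ hx0, map_one, map_one]
  refine le_antisymm h1 ?_
  rw [← h3]
  exact mul_le_of_le_one_right' h2

theorem exists_finiteLocalNorm_sub_one_le (v : HeightOneSpectrum (𝓞 K))
    (w : HeightOneSpectrum (𝓞 L)) [w.asIdeal.LiesOver v.asIdeal] (j : ℕ) :
    ∃ k : ℕ, ∀ x : w.adicCompletion L, Valued.v (x - 1) ≤ WithZero.exp (-(k : ℤ)) →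
      Valued.v (finiteLocalNorm K L v w x - 1) ≤ WithZero.exp (-(j : ℤ)) :=
  exists_valued_sub_le_subset w (((isOpen_valued_sub_le v 1 j).preimage
    (continuous_finiteLocalNorm v w)).mem_nhds (by simp))

/-- Local norms send units to units, and only the finitely many primes above divisors of `m` need a
congruence, supplied by continuity of the local norm. This replaces continuity of the full idele
norm. -/
theorem exists_ideleNorm_mem_congruenceIdeles [IsTotallyComplex K] {m : Ideal (𝓞 K)}
    (hm : m ≠ ⊥) : ∃ m' : Ideal (𝓞 L), m' ≠ ⊥ ∧
      ∀ α ∈ congruenceIdeles m', ideleNorm K L α ∈ congruenceIdeles m := by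
  classical
  have hk : ∀ w : HeightOneSpectrum (𝓞 L), ∃ k : ℕ, ∀ v : HeightOneSpectrum (𝓞 K),
      (_ : w.asIdeal.LiesOver v.asIdeal) → ∀ x : w.adicCompletion L,
        Valued.v (x - 1) ≤ WithZero.exp (-(k : ℤ)) → Valued.v (finiteLocalNorm K L v w x - 1) ≤
          WithZero.exp (-(multiplicity v.asIdeal m : ℤ)) := by
    intro w
    by_cases h : ∃ v : HeightOneSpectrum (𝓞 K), w.asIdeal.LiesOver v.asIdeal
    · obtain ⟨v, hv⟩ := h
      obtain ⟨k, hk⟩ := exists_finiteLocalNorm_sub_one_le v w (multiplicity v.asIdeal m)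
      refine ⟨k, fun v' hv' ↦ ?_⟩
      obtain rfl : v' = v := HeightOneSpectrum.ext (hv'.over.trans hv.over.symm)
      exact hk
    · exact ⟨0, fun v hv ↦ absurd ⟨v, hv⟩ h⟩
  choose k hk using hk
  have hfin : {w : HeightOneSpectrum (𝓞 L) | ∃ v : HeightOneSpectrum (𝓞 K),
      v.asIdeal ∣ m ∧ w.asIdeal.LiesOver v.asIdeal}.Finite := by
    refine ((Ideal.finite_factors hm).biUnion (t := fun v : HeightOneSpectrum (𝓞 K) ↦
      {w : HeightOneSpectrum (𝓞 L) | w.asIdeal.LiesOver v.asIdeal}) fun v _ ↦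
        Set.finite_coe_iff.1 (inferInstanceAs
          (Finite {w : HeightOneSpectrum (𝓞 L) // w.asIdeal.LiesOver v.asIdeal}))).subset ?_
    rintro w ⟨v, hv, hw⟩
    exact Set.mem_biUnion (x := v) hv hw
  have hm' : ∏ w ∈ hfin.toFinset, w.asIdeal ^ k w ≠ ⊥ :=
    Finset.prod_ne_zero_iff.2 fun p _ ↦ pow_ne_zero _ p.ne_bot
  refine ⟨_, hm', fun α hα ↦ ?_⟩
  rw [mem_congruenceIdeles_iff]
  intro v
  refine finprod_induction (fun y : v.adicCompletion K ↦ Valued.v y = 1 ∧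
    Valued.v (y - 1) ≤ WithZero.exp (-(multiplicity v.asIdeal m : ℤ))) (by simp) ?_ ?_
  · rintro y z ⟨hy, hy'⟩ ⟨hz, hz'⟩
    refine ⟨by rw [map_mul, hy, hz, one_mul], ?_⟩
    have : y * z - 1 = y * (z - 1) + (y - 1) := by ring
    rw [this]
    exact Valuation.map_add_le _ (by rwa [map_mul, hy, one_mul]) hy'
  · rintro ⟨w, hw⟩
    have h1 : Valued.v (finiteLocalNorm K L v w (α.1.2 w)) = 1 :=
      valued_finiteLocalNorm_eq_one v w (hα.1 w).1
    refine ⟨h1, ?_⟩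
    by_cases hv : v.asIdeal ∣ m
    · refine hk w v hw _ ((hα.1 w).2.trans ?_)
      rw [WithZero.exp_le_exp, neg_le_neg_iff, Nat.cast_le]
      refine FiniteMultiplicity.le_multiplicity_of_pow_dvd
        (FiniteMultiplicity.of_prime_left w.prime hm') (Finset.dvd_prod_of_mem _ ?_)
      exact hfin.mem_toFinset.2 ⟨v, hv, hw⟩
    · rw [multiplicity_eq_zero.2 hv]
      simpa using Valuation.map_sub_le (v := Valued.v) h1.le (map_one Valued.v).le

end IdeleNorm

/-! ### The absolute norm as a Hecke character -/

section IdeleAbs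
variable {F : Type*} [Field F] [NumberField F]

theorem norm_eq_one_of_valued_eq_one {p : HeightOneSpectrum (𝓞 F)} {x : p.adicCompletion F}
    (hx : Valued.v x = 1) : ‖x‖ = 1 := by
  rw [FinitePlace.norm_def, hx, map_one, NNReal.coe_one]

theorem finite_mulSupport_norm (α : Ideles F) :
    (Function.mulSupport fun p : HeightOneSpectrum (𝓞 F) ↦ ‖α.1.2 p‖).Finite := by
  have hα : IsUnit α.1.2 := ⟨Units.map (RingHom.snd (InfiniteAdeleRing F)
    (FiniteAdeleRing (𝓞 F) F)).toMonoidHom α, rfl⟩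
  have hfin : {p : HeightOneSpectrum (𝓞 F) | Valued.v (α.1.2 p) ≠ 1}.Finite :=
    (FiniteAdeleRing.isUnit_iff.1 hα).2
  exact hfin.subset fun p hp h ↦ hp (norm_eq_one_of_valued_eq_one h)

/-- The absolute norm of ideles as a homomorphism. -/
noncomputable def ideleAbsHom : Ideles F →* ℂˣ :=
  MonoidHom.toHomUnits
    { toFun α := (ideleAbs α : ℂ)
      map_one' := by
        have h1 : ∀ v, (1 : Ideles F).1.1 v = 1 := fun _ ↦ rfl
        have h2 : ∀ p, (1 : Ideles F).1.2 p = 1 := fun _ ↦ rfl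
        simp only [ideleAbs, h1, h2, norm_one, one_pow, Finset.prod_const_one, finprod_one,
          mul_one, Complex.ofReal_one]
      map_mul' α β := by
        have h1 : ∀ v, (α * β).1.1 v = α.1.1 v * β.1.1 v := fun _ ↦ rfl
        have h2 : ∀ p, (α * β).1.2 p = α.1.2 p * β.1.2 p := fun _ ↦ rfl
        simp only [ideleAbs, h1, h2, norm_mul, mul_pow, Finset.prod_mul_distrib]
        rw [finprod_mul_distrib (finite_mulSupport_norm α) (finite_mulSupport_norm β)]
        push_cast
        ring }

theorem ideleAbsHom_apply (α : Ideles F) : (ideleAbsHom α : ℂ) = ideleAbs α := rfl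

/-- The product formula. -/
theorem ideleAbsHom_principalIdele (x : Fˣ) : ideleAbsHom (principalIdele x) = 1 := by
  refine Units.ext ?_
  rw [ideleAbsHom_apply, Units.val_one, ← Complex.ofReal_one]
  congr 1
  rw [← prod_abs_eq_one x.ne_zero, ideleAbs,
    ← finprod_comp_equiv FinitePlace.equivHeightOneSpectrum.symm]
  congr 1
  refine Finset.prod_congr rfl fun v _ ↦ ?_
  congr 1
  exact InfinitePlace.Completion.norm_coe v ((WithAbs.equiv _).symm (x : F))

/-- The finite factors are `1`, and the normalized absolute value at a complex place is `z * conj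
z`, so every weight is `1`. -/
theorem ideleAbsHom_of_mem [IsTotallyComplex F] {m : Ideal (𝓞 F)} {α : Ideles F}
    (hα : α ∈ congruenceIdeles m) :
    ideleAbsHom α = infinityTypeHom (fun _ ↦ 1) (infinitePart α) := by
  refine Units.ext ?_
  rw [ideleAbsHom_apply, ideleAbs, finprod_eq_one_of_forall_eq_one fun p ↦
    norm_eq_one_of_valued_eq_one (hα.1 p).1, mul_one, infinityTypeHom_apply,
    prod_embeddings_eq_prod_places]
  push_cast
  refine Finset.prod_congr rfl fun v _ ↦ ?_
  rw [zpow_one, zpow_one, infiniteAdeleEmbedding_conjugate, Complex.mul_conj',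
    infiniteAdeleEmbedding_embedding,
    (IsTotallyComplex.isComplex v).mult_eq_two]
  congr 2
  exact ((InfinitePlace.Completion.isometry_extensionEmbedding v).norm_map_of_map_zero
    (map_zero _) _).symm

theorem continuous_ideleAbsHom [IsTotallyComplex F] : Continuous (ideleAbsHom (F := F)) :=
  continuous_of_eq_on_congruenceIdeles (m := ⊤) top_ne_bot (continuous_infinityTypeHom _)
    fun _ hα ↦ ideleAbsHom_of_mem hα

/-- The powers of the absolute norm as Hecke characters. -/
noncomputable def ideleAbsCharacter [IsTotallyComplex F] (k : ℤ) : HeckeCharacter F :=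
  heckeCharacterOfIdeles ((zpowGroupHom k).comp ideleAbsHom) (continuous_ideleAbsHom.zpow k)
    fun x ↦ by
      rw [MonoidHom.comp_apply]
      exact (congrArg _ (ideleAbsHom_principalIdele x)).trans (map_one _)

theorem ideleAbsCharacter_mk [IsTotallyComplex F] (k : ℤ) (α : Ideles F) :
    ideleAbsCharacter k (QuotientGroup.mk α : IdeleClassGroup F) = ideleAbsHom α ^ k := rfl

end IdeleAbs

/-! ### Extending characters of abelian groups -/

section Extension

/-- Characters with values in the divisible group `ℂˣ` extend. -/
theorem exists_comp_eq_of_forall_eq_one {A B : Type*} [CommGroup A] [CommGroup B] (f : A →* B)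
    (φ : A →* ℂˣ) (h : ∀ a, f a = 1 → φ a = 1) : ∃ ψ : B →* ℂˣ, ∀ a, ψ (f a) = φ a := by
  let Q := A ⧸ f.ker
  let f' : Q →* B := QuotientGroup.kerLift f
  let φ' : Q →* ℂˣ := QuotientGroup.lift f.ker φ h
  -- Roots exist in `ℂ`, so `ℂˣ` is divisible and thus an injective `ℤ`-module.
  let _ : DivisibleBy (Additive ℂˣ) ℕ := divisibleByOfSMulRightSurj _ _ fun {n} hn x ↦ by
    obtain ⟨z, hz⟩ := IsAlgClosed.exists_pow_nat_eq (x.toMul : ℂ) (Nat.pos_of_ne_zero hn)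
    have hz0 : z ≠ 0 := by
      rintro rfl
      exact x.toMul.ne_zero (by rw [← hz, zero_pow hn])
    exact ⟨Additive.ofMul (Units.mk0 z hz0), congrArg Additive.ofMul (Units.ext hz)⟩
  let _ : DivisibleBy (Additive ℂˣ) ℤ := AddGroup.divisibleByIntOfDivisibleByNat _
  obtain ⟨ψ, hψ⟩ := (Module.Baer.of_divisible (Additive ℂˣ)).extension_property
    (MonoidHom.toAdditive f').toIntLinearMap (QuotientGroup.kerLift_injective f)
    (MonoidHom.toAdditive φ').toIntLinearMap
  refine ⟨MonoidHom.toAdditive.symm ψ.toAddMonoidHom, ?_⟩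
  exact fun a ↦ LinearMap.congr_fun hψ (QuotientGroup.mk a : Q)

/-- A character trivial on `U ⊓ P` can be changed outside `U` to be trivial on `P`. -/
theorem exists_extension {G : Type*} [CommGroup G] (P U : Subgroup G) (φ : G →* ℂˣ)
    (h : ∀ a ∈ U, a ∈ P → φ a = 1) :
    ∃ ψ : G →* ℂˣ, (∀ a ∈ P, ψ a = 1) ∧ ∀ a ∈ U, ψ a = φ a := by
  -- The map `U → G ⧸ P` has kernel `U ⊓ P`; extend from its image to all of `G ⧸ P`.
  obtain ⟨ψ, hψ⟩ := exists_comp_eq_of_forall_eq_one ((QuotientGroup.mk' P).comp U.subtype)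
    (φ.comp U.subtype) fun a ha ↦ h a a.2 ((QuotientGroup.eq_one_iff (a : G)).1 ha)
  refine ⟨ψ.comp (QuotientGroup.mk' P), fun a ha ↦ ?_, fun a ha ↦ hψ ⟨a, ha⟩⟩
  rw [MonoidHom.comp_apply, QuotientGroup.mk'_apply, (QuotientGroup.eq_one_iff a).2 ha, map_one]

end Extension

/-! ### Algebraic integers with small conjugates -/

section Conjugates

instance : IsAlgClosed QBar := (algebraicClosure.isAlgClosure ℚ ℂ).isAlgClosed
instance : IsAlgClosure ℚ QBar := algebraicClosure.isAlgClosure ℚ ℂ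
instance : Normal ℚ QBar := IsAlgClosure.normal ℚ QBar

theorem coe_conjQBar (x : QBar) : ((conjQBar x : QBar) : ℂ) = starRingEnd ℂ (x : ℂ) := rfl

theorem conjQBar_conjQBar (x : QBar) : conjQBar (conjQBar x) = x :=
  Subtype.ext (Complex.conj_conj _)

/-- An algebraic integer all of whose conjugates have absolute value less than `1` vanishes. -/
theorem eq_zero_of_forall_norm_lt_one {β : QBar} (hβ : IsIntegral ℤ β)
    (h : ∀ γ : QBar ≃ₐ[ℚ] QBar, ‖((γ β : QBar) : ℂ)‖ < 1) : β = 0 := by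
  by_contra hne
  have h0 : (minpoly ℤ β).coeff 0 ≠ 0 := by
    intro h
    refine hne ((minpoly.coeff_zero_eq_zero (A := ℚ) hβ.tower_top).1 ?_)
    rw [minpoly.isIntegrallyClosed_eq_field_fractions' ℚ hβ, Polynomial.coeff_map, h, map_zero]
  let f : Polynomial QBar := (minpoly ℤ β).map (algebraMap ℤ QBar)
  have hf : f.Monic := (minpoly.monic hβ).map _
  have hf' : f = (minpoly ℚ β).map (algebraMap ℚ QBar) := by
    rw [minpoly.isIntegrallyClosed_eq_field_fractions' ℚ hβ, Polynomial.map_map]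
    congr 1
  have hroot : ∀ z ∈ f.roots, ‖(z : ℂ)‖ < 1 := by
    intro z hz
    have hz1 : Polynomial.aeval z (minpoly ℚ β) = 0 := by
      rw [Polynomial.mem_roots hf.ne_zero, Polynomial.IsRoot, hf', Polynomial.eval_map_algebraMap]
        at hz
      exact hz
    obtain ⟨γ, rfl⟩ := minpoly.exists_algEquiv_of_root' (Algebra.IsAlgebraic.isAlgebraic β) hz1
    exact h γ
  -- Up to sign the constant coefficient is the product of the conjugates: a nonzero integer of
  -- absolute value less than `1`, a contradiction.
  have hc : ((minpoly ℤ β).coeff 0 : QBar) = (-1) ^ f.natDegree * f.roots.prod := by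
    rw [← (IsAlgClosed.splits f).coeff_zero_eq_prod_roots_of_monic hf, Polynomial.coeff_map]
    rfl
  have hc' : (((minpoly ℤ β).coeff 0 : ℤ) : ℂ) =
      (-1) ^ f.natDegree * (f.roots.map (algebraMap QBar ℂ)).prod := by
    have := congrArg (algebraMap QBar ℂ) hc
    rwa [map_intCast, map_mul, map_pow, map_neg, map_one, map_multiset_prod] at this
  have hcard : 0 < f.roots.card := by
    rw [← (IsAlgClosed.splits f).natDegree_eq_card_roots, (minpoly.monic hβ).natDegree_map]
    exact minpoly.natDegree_pos hβ
  have key : ∀ s : Multiset QBar, 0 < s.card → (∀ z ∈ s, ‖(z : ℂ)‖ < 1) →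
      ‖(s.map (algebraMap QBar ℂ)).prod‖ < 1 := by
    intro s
    induction s using Multiset.induction with
    | empty => simp
    | cons a s ih =>
      intro _ hs
      rw [Multiset.map_cons, Multiset.prod_cons, norm_mul]
      have ha : ‖(a : ℂ)‖ < 1 := hs a (Multiset.mem_cons_self a s)
      rcases s.card.eq_zero_or_pos with h | h
      · rw [Multiset.card_eq_zero.1 h]
        simpa using ha
      · exact mul_lt_one_of_nonneg_of_lt_one_left (norm_nonneg _) ha
          (ih h fun z hz ↦ hs z (Multiset.mem_cons_of_mem hz)).le
  have hlt := key _ hcard hroot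
  have h1 : ‖(((minpoly ℤ β).coeff 0 : ℤ) : ℂ)‖ < 1 := by
    rw [hc', norm_mul, norm_pow, norm_neg, norm_one, one_pow, one_mul]
    exact hlt
  rw [Complex.norm_intCast] at h1
  have : |(minpoly ℤ β).coeff 0| < 1 := by exact_mod_cast h1
  exact h0 (Int.abs_lt_one_iff.1 this)

end Conjugates

/-! ### Units and pure weights -/

section Embeddings
variable {F : Type*} [Field F]

theorem toComplex_injective : Function.Injective (toComplex (F := F)) := fun _ _ h ↦
  RingHom.ext fun x ↦ Subtype.ext (RingHom.congr_fun h x)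

/-- Galois automorphisms permute the embeddings. -/
noncomputable def galoisPerm (γ : QBar ≃ₐ[ℚ] QBar) : Equiv.Perm (F →+* QBar) where
  toFun τ := (γ : QBar →+* QBar).comp τ
  invFun τ := (γ.symm : QBar →+* QBar).comp τ
  left_inv τ := RingHom.ext fun x ↦ γ.symm_apply_apply (τ x)
  right_inv τ := RingHom.ext fun x ↦ γ.apply_symm_apply (τ x)

theorem galoisPerm_apply (γ : QBar ≃ₐ[ℚ] QBar) (τ : F →+* QBar) (x : F) :
    galoisPerm γ τ x = γ (τ x) := rfl

theorem galoisPerm_conjQBar_symm (τ : F →+* QBar) :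
    (galoisPerm conjQBar).symm τ = galoisPerm conjQBar τ := by
  rw [Equiv.symm_apply_eq]
  exact RingHom.ext fun x ↦ (conjQBar_conjQBar (τ x)).symm

theorem IsPure.galoisPerm_add {n : (F →+* ℂ) → ℤ} {w : ℤ} (hn : IsPure n w)
    (γ : QBar ≃ₐ[ℚ] QBar) (τ : F →+* QBar) :
    n (toComplex (galoisPerm γ τ)) + n (toComplex (galoisPerm γ (galoisPerm conjQBar τ))) = w :=
  hn γ τ

variable [NumberField F]

theorem toComplex_bijective : Function.Bijective (toComplex (F := F)) := by
  refine ⟨toComplex_injective, fun τ ↦ ⟨τ.codRestrict QBar.toSubring fun x ↦ ?_, rfl⟩⟩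
  exact (Algebra.IsIntegral.isIntegral (R := ℚ) x).map τ.toRatAlgHom

/-- Embeddings into the algebraic closure of `ℚ` in `ℂ` are the same as embeddings into `ℂ`. -/
noncomputable def embeddingEquiv : (F →+* QBar) ≃ (F →+* ℂ) :=
  Equiv.ofBijective toComplex toComplex_bijective

/-- The value at `x` of the algebraic torus character of weights `n`. -/
noncomputable def weightProd (n : (F →+* ℂ) → ℤ) (x : F) : QBar :=
  ∏ τ : F →+* QBar, τ x ^ n (toComplex τ)

theorem coe_weightProd (n : (F →+* ℂ) → ℤ) (x : F) :
    (weightProd n x : ℂ) = ∏ τ : F →+* ℂ, τ x ^ n τ := by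
  have : (weightProd n x : ℂ) = algebraMap QBar ℂ (weightProd n x) := rfl
  rw [this, weightProd, map_prod]
  refine Fintype.prod_equiv embeddingEquiv _ _ fun τ ↦ ?_
  rw [map_zpow₀]
  rfl

/-- Multiplying by the complex conjugate pairs the exponents so that they add up to `w`, leaving the
`w`-th power of the norm of `u`, which is `±1`. -/
theorem norm_galois_weightProd_unit {n : (F →+* ℂ) → ℤ} {w : ℤ} (hn : IsPure n w)
    (u : (𝓞 F)ˣ) (γ : QBar ≃ₐ[ℚ] QBar) :
    ‖((γ (weightProd n (u : F)) : QBar) : ℂ)‖ = 1 := by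
  set ε := γ (weightProd n (u : F)) with hε
  have hu : ∀ τ : F →+* QBar, τ (u : F) ≠ 0 := fun τ ↦ by simp
  have h1 : ε = ∏ τ : F →+* QBar, τ (u : F) ^ n (toComplex ((galoisPerm γ).symm τ)) := by
    rw [hε, weightProd, map_prod]
    refine Fintype.prod_equiv (galoisPerm γ) _ _ fun τ ↦ ?_
    rw [map_zpow₀, Equiv.symm_apply_apply, galoisPerm_apply]
  have h2 : conjQBar ε = ∏ τ : F →+* QBar,
      τ (u : F) ^ n (toComplex ((galoisPerm γ).symm (galoisPerm conjQBar τ))) := by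
    rw [h1, map_prod]
    refine Fintype.prod_equiv (galoisPerm conjQBar) _ _ fun τ ↦ ?_
    rw [map_zpow₀, ← galoisPerm_apply, ← galoisPerm_conjQBar_symm (galoisPerm conjQBar τ),
      Equiv.symm_apply_apply]
  have h3 : ε * conjQBar ε = (∏ τ : F →+* QBar, τ (u : F)) ^ w := by
    rw [h2, h1, ← Finset.prod_mul_distrib, ← Finset.prod_zpow]
    refine Finset.prod_congr rfl fun τ _ ↦ ?_
    rw [← zpow_add₀ (hu τ)]
    congr 1
    exact hn.galoisPerm_add γ.symm τ
  have h4 : ‖((∏ τ : F →+* QBar, τ (u : F) : QBar) : ℂ)‖ = 1 := by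
    have h5 : ((∏ τ : F →+* QBar, τ (u : F) : QBar) : ℂ) = ∏ τ : F →ₐ[ℚ] ℂ, τ (u : F) := by
      change algebraMap QBar ℂ _ = _
      rw [map_prod]
      exact Fintype.prod_equiv (embeddingEquiv.trans (RingHom.equivRatAlgHom F ℂ)) _ _
        fun τ ↦ rfl
    rw [h5, ← Algebra.norm_eq_prod_embeddings ℚ ℂ, eq_ratCast, Complex.norm_ratCast]
    have := NumberField.Units.norm F u
    exact_mod_cast this
  have h6 := congrArg (fun z : QBar ↦ ‖(z : ℂ)‖) h3
  have h7 : ∀ z : QBar, ‖((z ^ w : QBar) : ℂ)‖ = ‖(z : ℂ)‖ ^ w := fun z ↦ by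
    change ‖algebraMap QBar ℂ (z ^ w)‖ = _
    rw [map_zpow₀, norm_zpow]
    rfl
  simp only [h7, h4, one_zpow, IntermediateField.coe_mul, coe_conjQBar, norm_mul,
    RCLike.norm_conj] at h6
  exact (mul_self_eq_one_iff.1 h6).resolve_right (by linarith [norm_nonneg (ε : ℂ)])

/-- Each factor is a unit of the ring of all algebraic integers congruent to `1` modulo `k`; working
in the unit group makes negative exponents harmless. -/
theorem exists_weightProd_unit_sub_one_eq (n : (F →+* ℂ) → ℤ) (u : (𝓞 F)ˣ) (k : ℤ)
    (hu : (k : 𝓞 F) ∣ u - 1) :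
    ∃ β : QBar, IsIntegral ℤ β ∧ weightProd n (u : F) - 1 = k * β := by
  let S := integralClosure ℤ QBar
  let r : (F →+* QBar) → (𝓞 F →+* S) := fun τ ↦
    (τ.comp (algebraMap (𝓞 F) F)).codRestrict S.toSubring fun x ↦
      (RingOfIntegers.isIntegral x).map (τ.comp (algebraMap (𝓞 F) F)).toIntAlgHom
  let e : Sˣ := ∏ τ : F →+* QBar, Units.map (r τ : 𝓞 F →* S) u ^ n (toComplex τ)
  have he : ((e : S) : QBar) = weightProd n (u : F) := by
    have h1 : ∀ z : Sˣ, ((z : S) : QBar) =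
      ((Units.map (algebraMap S QBar : S →* QBar) z : QBarˣ) : QBar) := fun _ ↦ rfl
    rw [h1, map_prod, Units.coe_prod]
    refine Finset.prod_congr rfl fun τ _ ↦ ?_
    rw [map_zpow, Units.val_zpow_eq_zpow_val]
    rfl
  let I : Ideal S := Ideal.span {(k : S)}
  have h2 : Units.map (Ideal.Quotient.mk I : S →* S ⧸ I) e = 1 := by
    rw [map_prod]
    refine Finset.prod_eq_one fun τ _ ↦ ?_
    rw [map_zpow]
    have : Units.map (Ideal.Quotient.mk I : S →* S ⧸ I) (Units.map (r τ : 𝓞 F →* S) u) = 1 := by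
      refine Units.ext ?_
      change Ideal.Quotient.mk I (r τ u) = Ideal.Quotient.mk I 1
      rw [Ideal.Quotient.eq, Ideal.mem_span_singleton, ← map_one (r τ), ← map_sub,
        ← map_intCast (r τ)]
      exact map_dvd _ hu
    rw [this, one_zpow]
  have h3 : (k : S) ∣ e - 1 := by
    rw [← Ideal.mem_span_singleton, ← Ideal.Quotient.eq]
    exact congrArg Units.val h2
  obtain ⟨β, hβ⟩ := h3
  refine ⟨β, β.2, ?_⟩
  rw [← he]
  exact_mod_cast congrArg (fun z : S ↦ (z : QBar)) hβ

/-- Two points of the unit circle are at distance at most 2, so the modulus 3 forces `|γ β| ≤ 2/3`.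
The modulus 2 would not exclude the value `-1`. -/
theorem prod_embeddings_unit_eq_one {n : (F →+* ℂ) → ℤ} {w : ℤ} (hn : IsPure n w)
    {u : (𝓞 F)ˣ} (hu : (3 : 𝓞 F) ∣ u - 1) : ∏ τ : F →+* ℂ, τ (u : F) ^ n τ = 1 := by
  obtain ⟨β, hβ, h⟩ := exists_weightProd_unit_sub_one_eq n u 3 (by exact_mod_cast hu)
  have h0 : β = 0 := by
    refine eq_zero_of_forall_norm_lt_one hβ fun γ ↦ ?_
    have h1 : ((γ (weightProd n (u : F)) : QBar) : ℂ) - 1 = 3 * ((γ β : QBar) : ℂ) := by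
      have h2 : γ (weightProd n (u : F)) - 1 = 3 * γ β := by
        rw [← map_one γ, ← map_sub, h, map_mul, map_intCast, Int.cast_ofNat]
      have h3 := congrArg (algebraMap QBar ℂ) h2
      rwa [map_sub, map_one, map_mul, map_ofNat] at h3
    have h2 := norm_sub_le ((γ (weightProd n (u : F)) : QBar) : ℂ) 1
    rw [h1, norm_galois_weightProd_unit hn, norm_mul, norm_one] at h2
    norm_num at h2
    linarith
  rw [← coe_weightProd, sub_eq_zero.1 (h.trans (by rw [h0, mul_zero]))]
  rfl

end Embeddings

/-! ### Existence of a Hecke character with pure infinity type -/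

section Existence
variable {F : Type*} [Field F] [NumberField F]

theorem exists_unit_of_principalIdele_mem [IsTotallyComplex F] {a : 𝓞 F} (ha : a ≠ 0) {x : Fˣ}
    (hx : principalIdele x ∈ congruenceIdeles (Ideal.span {a})) :
    ∃ u : (𝓞 F)ˣ, ((u : 𝓞 F) : F) = x ∧ a ∣ u - 1 := by
  rw [mem_congruenceIdeles_iff] at hx
  have hx1 : ∀ p : HeightOneSpectrum (𝓞 F), p.valuation F (x : F) = 1 := fun p ↦
    (valued_algebraMap p (x : F)).symm.trans (hx p).1
  have hx2 : ∀ p : HeightOneSpectrum (𝓞 F), p.valuation F ((x : F) - 1) ≤ p.intValuation a := by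
    intro p
    rw [p.intValuation_eq_exp_neg_multiplicity ha, ← valued_algebraMap, map_sub, map_one]
    exact (hx p).2
  have ha' : algebraMap (𝓞 F) F a ≠ 0 := by simpa using ha
  obtain ⟨y, hy⟩ := HeightOneSpectrum.mem_integers_of_valuation_le_one F (x : F)
    fun p ↦ (hx1 p).le
  obtain ⟨z, hz⟩ := HeightOneSpectrum.mem_integers_of_valuation_le_one F ((x : F)⁻¹)
    fun p ↦ by rw [map_inv₀, hx1 p, inv_one]
  obtain ⟨b, hb⟩ := HeightOneSpectrum.mem_integers_of_valuation_le_one F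
    (((x : F) - 1) / algebraMap (𝓞 F) F a) fun p ↦ by
      rw [map_div₀, HeightOneSpectrum.valuation_of_algebraMap]
      exact div_le_one_of_le₀ (hx2 p) zero_le
  have hyz : y * z = 1 := by
    apply FaithfulSMul.algebraMap_injective (𝓞 F) F
    rw [map_mul, hy, hz, map_one, mul_inv_cancel₀ x.ne_zero]
  refine ⟨⟨y, z, hyz, by rw [mul_comm, hyz]⟩, hy, b, ?_⟩
  apply FaithfulSMul.algebraMap_injective (𝓞 F) F
  rw [map_mul, hb, mul_div_cancel₀ _ ha', map_sub, hy, map_one]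

theorem infinityTypeHom_infinitePart_eq_one [IsTotallyComplex F] {n : (F →+* ℂ) → ℤ} {w : ℤ}
    (hn : IsPure n w) {α : Ideles F} (hα : α ∈ congruenceIdeles (Ideal.span {(3 : 𝓞 F)}))
    (h : α ∈ principalIdeles F) : infinityTypeHom n (infinitePart α) = 1 := by
  obtain ⟨x, hx⟩ := h
  obtain rfl : principalIdele x = α := hx
  obtain ⟨u, hu, hu'⟩ := exists_unit_of_principalIdele_mem (by norm_num) hα
  refine Units.ext ?_
  rw [infinityTypeHom_apply, Units.val_one, ← prod_embeddings_unit_eq_one hn hu']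
  refine Finset.prod_congr rfl fun τ _ ↦ ?_
  congr 1
  exact (infiniteAdeleEmbedding_algebraMap τ (x : F)).trans (congrArg τ hu.symm)

/-- Pure weights are the infinity type of a Hecke character. -/
theorem exists_heckeCharacter [IsTotallyComplex F] {n : (F →+* ℂ) → ℤ} {w : ℤ}
    (hn : IsPure n w) : ∃ χ : HeckeCharacter F, HasInfinityType χ n ∧
      ∃ m : Ideal (𝓞 F), m ≠ ⊥ ∧ ∀ α ∈ congruenceIdeles m,
        χ (QuotientGroup.mk α) = infinityTypeHom n (infinitePart α) := by
  have hm : Ideal.span {(3 : 𝓞 F)} ≠ ⊥ := by simp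
  obtain ⟨f, hP, hf⟩ := exists_extension (principalIdeles F)
    (congruenceIdeles (Ideal.span {(3 : 𝓞 F)})) ((infinityTypeHom n).comp infinitePart)
    fun α hα h ↦ infinityTypeHom_infinitePart_eq_one hn hα h
  generalize Ideal.span {(3 : 𝓞 F)} = m at hf hm
  refine ⟨heckeCharacterOfIdeles f
    (continuous_of_eq_on_congruenceIdeles hm (continuous_infinityTypeHom n) hf)
    fun x ↦ hP _ ⟨x, rfl⟩, (hasInfinityType_iff _ n).2 fun x ↦ ?_, m, hm, fun α hα ↦ ?_⟩
  · rw [heckeCharacterOfIdeles_mk, hf _ (infiniteIdele_mem_congruenceIdeles m x)]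
    rfl
  · rw [heckeCharacterOfIdeles_mk, hf α hα]
    rfl

end Existence

/-! ### Identification of `F₁` with `conjSubfield F` -/

section ConjSubfield
variable (F : Type*) [Field F]

/-- The largest subfield on which complex conjugation commutes with all complex embeddings. -/
def conjSubfield : Subfield F where
  carrier := {x | ∃ y, ∀ τ : F →+* ℂ, τ y = starRingEnd ℂ (τ x)}
  zero_mem' := ⟨0, by simp⟩
  one_mem' := ⟨1, by simp⟩
  add_mem' := by
    rintro x x' ⟨y, hy⟩ ⟨y', hy'⟩
    exact ⟨y + y', fun τ ↦ by rw [map_add, map_add, hy, hy', map_add]⟩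
  mul_mem' := by
    rintro x x' ⟨y, hy⟩ ⟨y', hy'⟩
    exact ⟨y * y', fun τ ↦ by rw [map_mul, map_mul, hy, hy', map_mul]⟩
  neg_mem' := by
    rintro x ⟨y, hy⟩
    exact ⟨-y, fun τ ↦ by rw [map_neg, map_neg, hy, map_neg]⟩
  inv_mem' := by
    rintro x ⟨y, hy⟩
    exact ⟨y⁻¹, fun τ ↦ by rw [map_inv₀, map_inv₀, hy, map_inv₀]⟩

variable {F}

/-- An element all of whose complex embeddings are purely imaginary. -/
def IsTotallyImaginary (e : F) : Prop := ∀ τ : F →+* ℂ, starRingEnd ℂ (τ e) = -τ e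

theorem maximalRealSubfield_le_conjSubfield : maximalRealSubfield F ≤ conjSubfield F :=
  fun x hx ↦ ⟨x, fun τ ↦ (hx τ).symm⟩

theorem IsTotallyImaginary.mem_conjSubfield {e : F} (he : IsTotallyImaginary e) :
    e ∈ conjSubfield F := ⟨-e, fun τ ↦ by rw [he, map_neg]⟩

variable [NumberField F]

theorem IsTotallyImaginary.eq_zero {e : F} (he : IsTotallyImaginary e)
    (h : e ∈ maximalRealSubfield F) : e = 0 := by
  obtain ⟨τ⟩ : Nonempty (F →+* ℂ) := inferInstance
  have h1 : τ e = -τ e := (h τ).symm.trans (he τ)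
  exact (map_eq_zero τ).1 (self_eq_neg.1 h1)

/-- With `y` the conjugate of `x`, conjugation swaps `x` and `y` and negates `e`, so `(x + y) / 2`
and `(x - y) / (2 * e)` are totally real. -/
theorem IsTotallyImaginary.exists_eq_add {e : F} (he : IsTotallyImaginary e) (he0 : e ≠ 0)
    {x : F} (hx : x ∈ conjSubfield F) :
    ∃ p ∈ maximalRealSubfield F, ∃ q ∈ maximalRealSubfield F, x = p + q * e := by
  obtain ⟨y, hy⟩ := hx
  refine ⟨(x + y) / 2, fun τ ↦ ?_, (x - y) / (2 * e), fun τ ↦ ?_, by field_simp; ring⟩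
  · simp only [map_div₀, map_add, hy, map_ofNat, RCLike.star_def, Complex.conj_conj]
    rw [add_comm]
  · have : τ e ≠ 0 := by simpa using he0
    simp only [map_div₀, map_sub, map_mul, hy, map_ofNat, RCLike.star_def, Complex.conj_conj,
      he τ]
    field_simp
    ring

theorem exists_isTotallyImaginary {x : F} (hx : x ∈ conjSubfield F)
    (hx' : x ∉ maximalRealSubfield F) : ∃ e : F, e ≠ 0 ∧ IsTotallyImaginary e := by
  obtain ⟨y, hy⟩ := hx
  refine ⟨y - x, fun h ↦ hx' fun τ ↦ ?_, fun τ ↦ ?_⟩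
  · rw [RCLike.star_def, ← hy, sub_eq_zero.1 h]
  · rw [map_sub, hy, map_sub, Complex.conj_conj, neg_sub]

/-- `1` and `e` form a basis over the totally real subfield. A real embedding would, extended to
`F`, make `e` both real and purely imaginary. -/
theorem isTotImagQuadratic_conjSubfield {e : F} (he : IsTotallyImaginary e) (he0 : e ≠ 0) :
    IsTotImagQuadratic (maximalRealSubfield F) (conjSubfield F) := by
  refine ⟨maximalRealSubfield_le_conjSubfield, ?_, ⟨fun v ↦ ?_⟩⟩
  · rw [Subfield.relfinrank_eq_finrank_of_le maximalRealSubfield_le_conjSubfield]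
    let E := Subfield.extendScalars (maximalRealSubfield_le_conjSubfield (F := F))
    let eE : E := ⟨e, he.mem_conjSubfield⟩
    let f : (maximalRealSubfield F × maximalRealSubfield F) →ₗ[maximalRealSubfield F] E :=
      (LinearMap.toSpanSingleton _ E 1).coprod (LinearMap.toSpanSingleton _ E eE)
    have hf : ∀ p q, ((f (p, q) : E) : F) = p + q * e := fun p q ↦ by
      change (p : F) * 1 + (q : F) * e = _
      rw [mul_one]
    have hinj : Function.Injective f := by
      rw [← LinearMap.ker_eq_bot, LinearMap.ker_eq_bot']
      rintro ⟨p, q⟩ h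
      have h1 : (p : F) + q * e = 0 := by rw [← hf, h]; rfl
      have hq : (q : F) = 0 := by
        by_contra hq
        refine he0 (he.eq_zero ?_)
        have : e = -p / q := by field_simp; linear_combination h1
        rw [this]
        exact div_mem (neg_mem p.2) q.2
      have hp : (p : F) = 0 := by simpa [hq] using h1
      exact Prod.ext (Subtype.ext hp) (Subtype.ext hq)
    have hsurj : Function.Surjective f := by
      rintro ⟨x, hx⟩
      obtain ⟨p, hp, q, hq, h⟩ := he.exists_eq_add he0 hx
      exact ⟨(⟨p, hp⟩, ⟨q, hq⟩), Subtype.ext ((hf _ _).trans h.symm)⟩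
    rw [← (LinearEquiv.ofBijective f ⟨hinj, hsurj⟩).finrank_eq, Module.finrank_prod,
      Module.finrank_self]
  · rw [← InfinitePlace.not_isReal_iff_isComplex, InfinitePlace.isReal_iff,
      ComplexEmbedding.isReal_iff]
    intro h
    let e' : conjSubfield F := ⟨e, he.mem_conjSubfield⟩
    have h1 : starRingEnd ℂ (v.embedding e') = v.embedding e' := RingHom.congr_fun h e'
    have h2 : v.embedding e' = ComplexEmbedding.lift F v.embedding e :=
      (ComplexEmbedding.lift_algebraMap_apply F v.embedding e').symm
    rw [h2, he] at h1
    exact he0 ((map_eq_zero _).1 (neg_eq_self.1 h1))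

theorem IsTotImagQuadratic.isCMField {K : Subfield F}
    (hK : IsTotImagQuadratic (maximalRealSubfield F) K) : IsCMField K := by
  obtain ⟨hle, hrank, hC⟩ := hK
  let _ : Algebra (maximalRealSubfield F) K := (Subfield.inclusion hle).toAlgebra
  have : Algebra.IsQuadraticExtension (maximalRealSubfield F) K := ⟨by
    rw [← hrank, Subfield.relfinrank_eq_finrank_of_le hle]
    rfl⟩
  exact IsCMField.ofCMExtension (maximalRealSubfield F) K

theorem le_conjSubfield_of_isCMField (K : Subfield F) [IsCMField K] : K ≤ conjSubfield F :=
  fun x hx ↦ ⟨IsCMField.complexConj K ⟨x, hx⟩, fun τ ↦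
    IsCMField.complexEmbedding_complexConj K (τ.comp K.subtype) ⟨x, hx⟩⟩

theorem exists_isTotallyImaginary_of_isCMField (K : Subfield F) [IsCMField K] :
    ∃ e ∈ K, e ≠ 0 ∧ IsTotallyImaginary e := by
  obtain ⟨x, hx⟩ : ∃ x, IsCMField.complexConj K x ≠ x := by
    by_contra! h
    exact IsCMField.complexConj_ne_one K (AlgEquiv.ext h)
  refine ⟨(IsCMField.complexConj K x - x : K), Subtype.prop _, ?_, fun τ ↦ ?_⟩
  · simpa [sub_eq_zero, Subtype.ext_iff] using hx
  · have h := IsCMField.complexEmbedding_complexConj K (τ.comp K.subtype)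
    have h1 := h (IsCMField.complexConj K x - x)
    rw [map_sub (IsCMField.complexConj K), IsCMField.complexConj_apply_apply, ← neg_sub,
      map_neg] at h1
    exact h1.symm

theorem conjSubfield_eq_maximalRealSubfield (h : ¬ ∃ e : F, e ≠ 0 ∧ IsTotallyImaginary e) :
    conjSubfield F = maximalRealSubfield F :=
  le_antisymm (fun _ hx ↦ by_contra fun hx' ↦ h (exists_isTotallyImaginary hx hx'))
    maximalRealSubfield_le_conjSubfield

/-- A quadratic `F₁` contains a totally imaginary `e`, and `F₀ + F₀ e` exhausts `conjSubfield F`.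
Otherwise no such `e` exists, as it would produce a quadratic extension. -/
theorem IsMaximalCMOrReal.eq_conjSubfield {F₁ : Subfield F} (h : IsMaximalCMOrReal F₁) :
    F₁ = conjSubfield F := by
  obtain h | ⟨rfl, h⟩ := h
  · have := h.isCMField
    refine le_antisymm (le_conjSubfield_of_isCMField F₁) fun x hx ↦ ?_
    obtain ⟨e, heF, he0, he⟩ := exists_isTotallyImaginary_of_isCMField F₁
    obtain ⟨p, hp, q, hq, rfl⟩ := he.exists_eq_add he0 hx
    exact add_mem (h.1 hp) (mul_mem (h.1 hq) heF)
  · refine (conjSubfield_eq_maximalRealSubfield ?_).symm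
    rintro ⟨e, he0, he⟩
    exact h ⟨_, isTotImagQuadratic_conjSubfield he he0⟩

theorem exists_isTotallyImaginary_iff :
    (∃ e : F, e ≠ 0 ∧ IsTotallyImaginary e) ↔ ∃ K : Subfield F, IsCMField K := by
  refine ⟨fun ⟨e, he0, he⟩ ↦ ⟨_, (isTotImagQuadratic_conjSubfield he he0).isCMField⟩, ?_⟩
  rintro ⟨K, hK⟩
  obtain ⟨e, -, he⟩ := exists_isTotallyImaginary_of_isCMField K
  exact ⟨e, he⟩

theorem conjSubfield_eq_maximalRealSubfield_iff :
    conjSubfield F = maximalRealSubfield F ↔ ¬ ∃ K : Subfield F, IsCMField K := by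
  rw [← exists_isTotallyImaginary_iff]
  refine ⟨?_, conjSubfield_eq_maximalRealSubfield⟩
  rintro h ⟨e, he0, he⟩
  exact he0 (he.eq_zero (h ▸ he.mem_conjSubfield))

theorem isCMField_conjSubfield_iff :
    IsCMField (conjSubfield F) ↔ ∃ K : Subfield F, IsCMField K := by
  refine ⟨fun h ↦ ⟨_, h⟩, fun h ↦ ?_⟩
  obtain ⟨e, he0, he⟩ := exists_isTotallyImaginary_iff.2 h
  exact (isTotImagQuadratic_conjSubfield he he0).isCMField

end ConjSubfield

/-! ### Descent of pure weights by Galois theory -/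

section Purity
variable {F : Type*} [Field F]

/-- A conjugate of complex conjugation. -/
noncomputable def conjConjugate (γ : QBar ≃ₐ[ℚ] QBar) : QBar ≃ₐ[ℚ] QBar :=
  γ * conjQBar * γ⁻¹

theorem galoisPerm_mul (γ γ' : QBar ≃ₐ[ℚ] QBar) (τ : F →+* QBar) :
    galoisPerm (γ * γ') τ = galoisPerm γ (galoisPerm γ' τ) := rfl

theorem mul_conjConjugate (γ γ' : QBar ≃ₐ[ℚ] QBar) :
    γ * conjConjugate γ' = conjConjugate (γ * γ') * γ := by
  simp only [conjConjugate]
  group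

theorem IsPure.conjConjugate {n : (F →+* ℂ) → ℤ} {w : ℤ} (hn : IsPure n w)
    (γ : QBar ≃ₐ[ℚ] QBar) (τ : F →+* QBar) :
    n (toComplex τ) + n (toComplex (galoisPerm (conjConjugate γ) τ)) = w := by
  have h := hn.galoisPerm_add γ (galoisPerm γ⁻¹ τ)
  rwa [← galoisPerm_mul, mul_inv_cancel] at h

/-- The automorphisms which can be inserted next to `σ` without changing the weight. -/
def weightStabilizer (n : (F →+* ℂ) → ℤ) (σ : F →+* QBar) : Subgroup (QBar ≃ₐ[ℚ] QBar) where
  carrier := {g | ∀ h, n (toComplex (galoisPerm (h * g) σ)) = n (toComplex (galoisPerm h σ))}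
  one_mem' h := by rw [mul_one]
  mul_mem' {g g'} hg hg' h := by rw [← mul_assoc, hg', hg]
  inv_mem' {g} hg h := by rw [← hg, inv_mul_cancel_right]

/-- Moved to the left of `h`, each factor is again a conjugate of complex conjugation and turns a
weight into `w` minus it; two such reflections cancel. -/
theorem IsPure.conjConjugate_mul_mem {n : (F →+* ℂ) → ℤ} {w : ℤ} (hn : IsPure n w)
    (σ : F →+* QBar) (γ γ' : QBar ≃ₐ[ℚ] QBar) :
    HeckeChar.conjConjugate γ * HeckeChar.conjConjugate γ' ∈ weightStabilizer n σ := by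
  intro h
  rw [← mul_assoc, mul_conjConjugate h γ, mul_assoc, mul_conjConjugate h γ', galoisPerm_mul,
    galoisPerm_mul]
  have h1 := hn.conjConjugate (h * γ) (galoisPerm (HeckeChar.conjConjugate (h * γ')) (galoisPerm h σ))
  have h2 := hn.conjConjugate (h * γ') (galoisPerm h σ)
  linarith

variable [NumberField F]

theorem exists_galoisPerm_eq (σ σ' : F →+* QBar) :
    ∃ g : QBar ≃ₐ[ℚ] QBar, galoisPerm g σ = σ' := by
  let χ : σ.toRatAlgHom.fieldRange ≃ₐ[ℚ] σ'.toRatAlgHom.fieldRange :=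
    (AlgEquiv.ofInjectiveField σ.toRatAlgHom).symm.trans
      (AlgEquiv.ofInjectiveField σ'.toRatAlgHom)
  refine ⟨χ.liftNormal QBar, RingHom.ext fun x ↦ ?_⟩
  have h := χ.liftNormal_commutes QBar (AlgEquiv.ofInjectiveField σ.toRatAlgHom x)
  have h1 : χ (AlgEquiv.ofInjectiveField σ.toRatAlgHom x) =
      AlgEquiv.ofInjectiveField σ'.toRatAlgHom x :=
    congrArg (AlgEquiv.ofInjectiveField σ'.toRatAlgHom)
      (AlgEquiv.symm_apply_apply (AlgEquiv.ofInjectiveField σ.toRatAlgHom) x)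
  rw [h1] at h
  exact h

/-- A fixed `x` lies in `σ(F)`, and all conjugates of complex conjugation act on it alike. Hence its
complex conjugate lies in `σ(F)` too and is carried along correctly by every embedding. -/
theorem IsPure.exists_eq_of_mem_fixedField {n : (F →+* ℂ) → ℤ} {w : ℤ} (hn : IsPure n w)
    (σ : F →+* QBar) {x : QBar}
    (hx : x ∈ IntermediateField.fixedField (weightStabilizer n σ)) :
    ∃ y ∈ conjSubfield F, σ y = x := by
  let L : IntermediateField ℚ QBar := σ.toRatAlgHom.fieldRange
  have hL : ∀ z, (∀ s ∈ L.fixingSubgroup, s z = z) → ∃ y, σ y = z := by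
    intro z hz
    have : z ∈ L := by
      rw [← InfiniteGalois.fixedField_fixingSubgroup L, IntermediateField.mem_fixedField_iff]
      exact hz
    exact this
  have hsσ : ∀ s ∈ L.fixingSubgroup, galoisPerm s σ = σ := fun s hs ↦
    RingHom.ext fun y ↦ (IntermediateField.mem_fixingSubgroup_iff L s).1 hs _ ⟨y, rfl⟩
  rw [IntermediateField.mem_fixedField_iff] at hx
  have hs : ∀ s ∈ L.fixingSubgroup, s x = x := fun s hs ↦
    hx s fun h ↦ by rw [galoisPerm_mul, hsσ s hs]
  have hconj : ∀ γ : QBar ≃ₐ[ℚ] QBar, γ (conjQBar (γ⁻¹ x)) = conjQBar x := fun γ ↦ by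
    have h1 : conjQBar (γ (conjQBar (γ⁻¹ x))) = x := hx _ (hn.conjConjugate_mul_mem σ 1 γ)
    rw [← h1, conjQBar_conjQBar, h1]
  obtain ⟨y, rfl⟩ := hL x hs
  obtain ⟨z, hz⟩ := hL (conjQBar (σ y)) fun s hs' ↦ by
    have h1 := hconj s
    rwa [hs _ (inv_mem hs')] at h1
  refine ⟨y, ⟨z, fun τ ↦ ?_⟩, rfl⟩
  obtain ⟨τ, rfl⟩ := toComplex_bijective.2 τ
  obtain ⟨g, rfl⟩ := exists_galoisPerm_eq σ τ
  have h1 := hconj g⁻¹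
  rw [inv_inv] at h1
  have h2 : g (σ z) = conjQBar (g (σ y)) := by
    rw [hz, ← h1]
    exact g.apply_symm_apply _
  exact congrArg Subtype.val h2

/-- Pure weights only depend on the restriction of an embedding to `conjSubfield F`. -/
theorem IsPure.eq_of_comp_eq {n : (F →+* ℂ) → ℤ} {w : ℤ} (hn : IsPure n w)
    {τ τ' : F →+* ℂ} (h : ∀ x ∈ conjSubfield F, τ x = τ' x) : n τ = n τ' := by
  obtain ⟨σ, rfl⟩ := toComplex_bijective.2 τ
  obtain ⟨σ', rfl⟩ := toComplex_bijective.2 τ'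
  obtain ⟨g, rfl⟩ := exists_galoisPerm_eq σ σ'
  let L : IntermediateField ℚ QBar := σ.toRatAlgHom.fieldRange
  have : FiniteDimensional ℚ L :=
    (AlgEquiv.ofInjectiveField σ.toRatAlgHom).toLinearEquiv.finiteDimensional
  have hle : L.fixingSubgroup ≤ weightStabilizer n σ := fun s hs h ↦ by
    have : galoisPerm s σ = σ :=
      RingHom.ext fun y ↦ (IntermediateField.mem_fixingSubgroup_iff L s).1 hs _ ⟨y, rfl⟩
    rw [galoisPerm_mul, this]
  -- The stabilizer contains the open subgroup fixing `σ(F)`, so it is open, hence closed, and the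
  -- infinite Galois correspondence recovers it from its fixed field.
  have hclosed : IsClosed (weightStabilizer n σ : Set (QBar ≃ₐ[ℚ] QBar)) :=
    Subgroup.isClosed_of_isOpen _ (Subgroup.isOpen_mono hle L.fixingSubgroup_isOpen)
  have hg : g ∈ weightStabilizer n σ := by
    have hfix := InfiniteGalois.fixingSubgroup_fixedField
      (⟨weightStabilizer n σ, hclosed⟩ : ClosedSubgroup (QBar ≃ₐ[ℚ] QBar))
    change g ∈ (⟨weightStabilizer n σ, hclosed⟩ : ClosedSubgroup (QBar ≃ₐ[ℚ] QBar)).1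
    rw [← hfix, IntermediateField.mem_fixingSubgroup_iff]
    intro x hx
    obtain ⟨y, hy, rfl⟩ := hn.exists_eq_of_mem_fixedField σ hx
    exact Subtype.ext (h y hy).symm
  have := hg 1
  rw [one_mul] at this
  exact this.symm

theorem IsPure.add_conjugate {n : (F →+* ℂ) → ℤ} {w : ℤ} (hn : IsPure n w) (τ : F →+* ℂ) :
    n τ + n (ComplexEmbedding.conjugate τ) = w := by
  obtain ⟨τ, rfl⟩ := toComplex_bijective.2 τ
  exact hn 1 τ

/-- `τ` and its conjugate agree on a totally real field, so they have the same weight and `2 n_τ =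
w`. -/
theorem IsPure.exists_const {n : (F →+* ℂ) → ℤ} {w : ℤ} (hn : IsPure n w)
    (h : conjSubfield F = maximalRealSubfield F) : ∃ k, ∀ τ, n τ = k := by
  obtain ⟨τ₀⟩ : Nonempty (F →+* ℂ) := inferInstance
  have h1 : ∀ τ, n τ + n τ = w := fun τ ↦ by
    nth_rw 2 [hn.eq_of_comp_eq (τ' := ComplexEmbedding.conjugate τ) fun x hx ↦ ?_]
    · exact hn.add_conjugate τ
    · rw [h] at hx
      exact (hx τ).symm
  exact ⟨n τ₀, fun τ ↦ by linarith [h1 τ, h1 τ₀]⟩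

/-- The weight of an embedding is that of any extension to `F`. Purity is inherited because
extending commutes with the Galois action up to the choice of extension, which does not matter. -/
theorem IsPure.exists_descent {n : (F →+* ℂ) → ℤ} {w : ℤ} (hn : IsPure n w) :
    ∃ m : (conjSubfield F →+* ℂ) → ℤ, IsPure m w ∧
      ∀ τ, n τ = m (τ.comp (algebraMap (conjSubfield F) F)) := by
  have hm : ∀ τ : F →+* ℂ, n τ =
      n (ComplexEmbedding.lift F (τ.comp (algebraMap (conjSubfield F) F))) := fun τ ↦
    hn.eq_of_comp_eq fun x hx ↦
      (ComplexEmbedding.lift_algebraMap_apply F (τ.comp (algebraMap (conjSubfield F) F))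
        ⟨x, hx⟩).symm
  refine ⟨fun ρ ↦ n (ComplexEmbedding.lift F ρ), fun γ ρ ↦ ?_, hm⟩
  obtain ⟨τ, hτ⟩ := toComplex_bijective.2 (ComplexEmbedding.lift F (toComplex ρ))
  obtain rfl : τ.comp (algebraMap (conjSubfield F) F) = ρ := by
    refine toComplex_injective ?_
    rw [← ComplexEmbedding.lift_comp_algebraMap F (toComplex ρ), ← hτ]
    rfl
  have key : ∀ σ : F →+* QBar, n (ComplexEmbedding.lift F
      (toComplex (σ.comp (algebraMap (conjSubfield F) F)))) = n (toComplex σ) :=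
    fun σ ↦ (hm (toComplex σ)).symm
  have h1 := key ((γ : QBar →+* QBar).comp τ)
  have h2 := key ((γ : QBar →+* QBar).comp ((conjQBar : QBar →+* QBar).comp τ))
  rw [RingHom.comp_assoc] at h1
  rw [RingHom.comp_assoc, RingHom.comp_assoc] at h2
  beta_reduce
  rw [h1, h2]
  exact hn γ τ

end Purity

/-! ### Hecke characters of a given infinity type -/

section Structure
variable {F : Type*} [Field F] [NumberField F] [IsTotallyComplex F]

theorem exists_dirichletCharacter_mul (χ χ' : HeckeCharacter F)
    (h : ∀ x, χ (QuotientGroup.mk (infiniteIdele F x)) =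
      χ' (QuotientGroup.mk (infiniteIdele F x))) :
    ∃ χ₀ : HeckeCharacter F, IsDirichletCharacter χ₀ ∧ IsOfFinOrder χ₀ ∧
      ∀ α : Ideles F, χ.eval α = χ'.eval α * χ₀.eval α := by
  have happ : ∀ a, (χ * χ'⁻¹) a = χ a * (χ' a)⁻¹ := fun _ ↦ rfl
  obtain ⟨h1, h2⟩ := isDirichletCharacter_of_trivial (χ * χ'⁻¹) fun x ↦ by
    rw [happ, h, mul_inv_cancel]
  refine ⟨χ * χ'⁻¹, h1, h2, fun α ↦ ?_⟩
  rw [HeckeCharacter.eval, HeckeCharacter.eval, HeckeCharacter.eval, happ, ← Units.val_mul,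
    mul_left_comm, mul_inv_cancel, mul_one]

theorem exists_eq_dirichletCharacter_mul_ideleAbs {n : (F →+* ℂ) → ℤ} {k : ℤ}
    (hk : ∀ τ, n τ = k) (χ : HeckeCharacter F) (hχ : HasInfinityType χ n) :
    ∃ χ₀ : HeckeCharacter F, IsDirichletCharacter χ₀ ∧ IsOfFinOrder χ₀ ∧
      ∀ α : Ideles F, χ.eval α = χ₀.eval α * (ideleAbs α : ℂ) ^ k := by
  obtain ⟨χ₀, h1, h2, h3⟩ := exists_dirichletCharacter_mul χ (ideleAbsCharacter k) fun x ↦ by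
    rw [(hasInfinityType_iff χ n).1 hχ, ideleAbsCharacter_mk,
      ideleAbsHom_of_mem (infiniteIdele_mem_congruenceIdeles ⊤ x), infinitePart_infiniteIdele]
    refine Units.ext ?_
    rw [Units.val_zpow_eq_zpow_val, infinityTypeHom_apply, infinityTypeHom_apply,
      ← Finset.prod_zpow]
    exact Finset.prod_congr rfl fun τ _ ↦ by rw [hk, zpow_one]
  refine ⟨χ₀, h1, h2, fun α ↦ ?_⟩
  have h4 : (ideleAbsCharacter k).eval α = (ideleAbs α : ℂ) ^ k := by
    rw [HeckeCharacter.eval, ideleAbsCharacter_mk, Units.val_zpow_eq_zpow_val, ideleAbsHom_apply]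
  rw [h3, mul_comm, h4]

variable {K : Type*} [Field K] [NumberField K] [IsTotallyComplex K] [Algebra K F]

/-- The explicit formula for `χ₁` on a congruence group, recorded in `exists_heckeCharacter`, gives
one for `χ₁ ∘ N` on a congruence group of `F`, and hence continuity. -/
theorem exists_heckeCharacter_comp_ideleNorm {χ₁ : HeckeCharacter K} {m : (K →+* ℂ) → ℤ}
    {I : Ideal (𝓞 K)} (hI : I ≠ ⊥) (hχ₁ : ∀ α ∈ congruenceIdeles I,
      χ₁ (QuotientGroup.mk α) = infinityTypeHom m (infinitePart α)) :
    ∃ χ : HeckeCharacter F, ∀ α : Ideles F,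
      χ (QuotientGroup.mk α) = χ₁ (QuotientGroup.mk (ideleNorm K F α)) := by
  obtain ⟨J, hJ, hJI⟩ := exists_ideleNorm_mem_congruenceIdeles (L := F) hI
  let f : Ideles F →* ℂˣ := (χ₁.toMonoidHom.comp (QuotientGroup.mk' (principalIdeles K))).comp
    (ideleNorm K F)
  have hf : ∀ α, f α = χ₁ (QuotientGroup.mk (ideleNorm K F α)) := fun _ ↦ rfl
  have hcont : Continuous f := continuous_of_eq_on_congruenceIdeles hJ
    (continuous_infinityTypeHom fun τ ↦ m (τ.comp (algebraMap K F))) fun α hα ↦ by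
      rw [hf, hχ₁ _ (hJI α hα), infinitePart_ideleNorm, infinityTypeHom_infiniteAdeleNorm]
  refine ⟨heckeCharacterOfIdeles f hcont fun x ↦ ?_, fun α ↦ rfl⟩
  have h1 : (QuotientGroup.mk (ideleNorm K F (principalIdele x)) : IdeleClassGroup K) = 1 := by
    rw [ideleNorm_principalIdele]
    exact (QuotientGroup.eq_one_iff _).2 ⟨_, rfl⟩
  exact (congrArg χ₁ h1).trans (map_one χ₁)

theorem exists_eq_comp_ideleNorm_mul_dirichletCharacter {m : (K →+* ℂ) → ℤ} {w : ℤ}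
    (hm : IsPure m w) {n : (F →+* ℂ) → ℤ} (hn : ∀ τ, n τ = m (τ.comp (algebraMap K F)))
    (χ : HeckeCharacter F) (hχ : HasInfinityType χ n) :
    ∃ (χ₁ : HeckeCharacter K) (χ₀ : HeckeCharacter F),
      HasInfinityType χ₁ m ∧ IsDirichletCharacter χ₀ ∧ IsOfFinOrder χ₀ ∧
      ∀ α : Ideles F, χ.eval α = χ₁.eval (ideleNorm K F α) * χ₀.eval α := by
  obtain ⟨χ₁, hχ₁, I, hI, hI'⟩ := exists_heckeCharacter hm
  obtain ⟨χ', hχ'⟩ := exists_heckeCharacter_comp_ideleNorm (F := F) hI hI'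
  obtain ⟨χ₀, h1, h2, h3⟩ := exists_dirichletCharacter_mul χ χ' fun x ↦ by
    rw [hχ', ideleNorm_infiniteIdele, (hasInfinityType_iff χ₁ m).1 hχ₁,
      infinityTypeHom_infiniteAdeleNorm, (hasInfinityType_iff χ n).1 hχ, funext hn]
  refine ⟨χ₁, χ₀, hχ₁, h1, h2, fun α ↦ ?_⟩
  have h4 : χ'.eval α = χ₁.eval (ideleNorm K F α) := congrArg Units.val (hχ' α)
  rw [h3, h4]

end Structure

end HeckeChar

theorem mainTheorem8 {F : Type*} [Field F] [NumberField F] [IsTotallyComplex F]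
    (n : (F →+* ℂ) → ℤ) (w : ℤ) (hn : IsPure n w)
    (F₁ : Subfield F) (hF₁ : IsMaximalCMOrReal F₁) :
    (∃ χ : HeckeCharacter F, HasInfinityType χ n) ∧
    ((F₁ = maximalRealSubfield F ↔ ¬ ∃ K : Subfield F, IsCMField K) ∧
      (IsCMField F₁ ↔ ∃ K : Subfield F, IsCMField K)) ∧
    (F₁ = maximalRealSubfield F →
      ∃ k : ℤ, (∀ τ, n τ = k) ∧
        ∀ χ : HeckeCharacter F, HasInfinityType χ n →
          ∃ χ₀ : HeckeCharacter F, IsDirichletCharacter χ₀ ∧ IsOfFinOrder χ₀ ∧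
            ∀ α : Ideles F, χ.eval α = χ₀.eval α * (ideleAbs α : ℂ) ^ k) ∧
    (IsCMField F₁ →
      ∃ m : (F₁ →+* ℂ) → ℤ, IsPure m w ∧ (∀ τ, n τ = m (τ.comp (algebraMap F₁ F))) ∧
        ∀ χ : HeckeCharacter F, HasInfinityType χ n →
          ∃ (χ₁ : HeckeCharacter F₁) (χ₀ : HeckeCharacter F),
            HasInfinityType χ₁ m ∧ IsDirichletCharacter χ₀ ∧ IsOfFinOrder χ₀ ∧
            ∀ α : Ideles F, χ.eval α = χ₁.eval (ideleNorm F₁ F α) * χ₀.eval α) := by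
  obtain ⟨χ, hχ, -⟩ := exists_heckeCharacter hn
  obtain rfl := hF₁.eq_conjSubfield
  refine ⟨⟨χ, hχ⟩, ⟨conjSubfield_eq_maximalRealSubfield_iff, isCMField_conjSubfield_iff⟩,
    fun h ↦ ?_, fun h ↦ ?_⟩
  · obtain ⟨k, hk⟩ := hn.exists_const h
    exact ⟨k, hk, exists_eq_dirichletCharacter_mul_ideleAbs hk⟩
  · obtain ⟨m, hm, hmn⟩ := hn.exists_descent
    exact ⟨m, hm, hmn, exists_eq_comp_ideleNorm_mul_dirichletCharacter hm hmn⟩
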